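/- For an integer $d\ge 2$ and real $t$ let $\Phi_{d,t}$ be the linear map on complex $d\times d$ matrices $$\Phi_{d,t}(\mu)=t\,\mu^{T}+(1-t)\,(\operatorname{tr}\mu)\,\frac{\mathbf I}{d},$$ where $\mu^T$ is the transpose and $\mathbf I$ the unit matrix (for $-\frac1{d-1}\le t\le\frac1{d+1}$ this is the transpose depolarizing channel). For a channel $\Phi$ let $h(\Phi)=\min_\rho S(\Phi(\rho))$ be its minimum output entropy, where $\rho$ runs over all density matrices (positive semidefinite, trace one) on the input space and $S(\sigma)=-\operatorname{tr}(\sigma\log\sigma)$ is the von Neumann entropy. Then all the minima below are attained, and: 1. For every $d\ge 2$ and every $t$ with $-\frac{1}{d-1}\le t\le \frac1{d+1}$ (in particular for $-\frac1{d-1}\le t\le 0$), $$h(\Phi_{d,t}\otimes\Phi_{d,t})=2\,h(\Phi_{d,t}).$$ 2. For all $d_1,d_2\ge 2$ (equal or not) and all $t_1,t_2$ with $-\frac1{d_i-1}\le t_i\le 0$ for $i=1,2$, $$h(\Phi_{d_1,t_1}\otimes\Phi_{d_2,t_2})=h(\Phi_{d_1,t_1})+h(\Phi_{d_2,t_2}).$$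 -/

import Mathlib

open scoped ComplexOrder Kronecker

noncomputable section

namespace TransposeDepolarizing

/-- A density matrix (state): positive semidefinite with unit trace. -/
def IsDensityMatrix {n : Type*} [Fintype n] (ρ : Matrix n n ℂ) : Prop :=
  ρ.PosSemidef ∧ ρ.trace = 1

/-- The von Neumann entropy `S(σ) = -Tr (σ log σ)` (natural logarithm, `0 log 0 = 0`); the
matrix logarithm is taken through the functional calculus of Hermitian matrices. -/
def vonNeumannEntropy {n : Type*} [Fintype n] [DecidableEq n] (σ : Matrix n n ℂ) : ℝ :=
  -((σ * cfc Real.log σ).trace).re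

/-- The transpose depolarizing map `μ ↦ t μᵀ + (1 - t) (Tr μ) I / d` on `d × d` matrices. -/
def channel (d : ℕ) (t : ℝ) : Matrix (Fin d) (Fin d) ℂ →ₗ[ℂ] Matrix (Fin d) (Fin d) ℂ where
  toFun μ := (t : ℂ) • μ.transpose +
    (((1 - t : ℝ) : ℂ) * μ.trace / (d : ℂ)) • (1 : Matrix (Fin d) (Fin d) ℂ)
  map_add' μ ν := by
    rw [Matrix.transpose_add, Matrix.trace_add, mul_add, add_div, add_smul, smul_add]
    abel
  map_smul' c μ := by
    rw [Matrix.transpose_smul, Matrix.trace_smul, RingHom.id_apply, smul_add, smul_smul,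
      smul_smul, smul_smul, smul_eq_mul, mul_comm (t : ℂ) c]
    congr 2
    ring

/-- The tensor product of two linear maps between matrix algebras, acting on matrices indexed by
pairs: the linear map with `A ⊗ₖ B ↦ Φ A ⊗ₖ Ψ B` (see `tensor_kronecker`), written out by
expanding the argument in matrix units. -/
def tensor {m n m' n' : Type*} [Fintype m] [Fintype n] [DecidableEq m] [DecidableEq n]
    (Φ : Matrix m m ℂ →ₗ[ℂ] Matrix m' m' ℂ) (Ψ : Matrix n n ℂ →ₗ[ℂ] Matrix n' n' ℂ) :
    Matrix (m × n) (m × n) ℂ →ₗ[ℂ] Matrix (m' × n') (m' × n') ℂ where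
  toFun X := ∑ i, ∑ j, ∑ k, ∑ l, X (i, k) (j, l) •
    (Φ (Matrix.single i j 1) ⊗ₖ Ψ (Matrix.single k l 1))
  map_add' X Y := by
    simp only [Matrix.add_apply, add_smul, Finset.sum_add_distrib]
  map_smul' c X := by
    simp only [Matrix.smul_apply, smul_eq_mul, mul_smul, Finset.smul_sum, RingHom.id_apply]

theorem map_eq_sum {m m' : Type*} [Fintype m] [DecidableEq m]
    (Φ : Matrix m m ℂ →ₗ[ℂ] Matrix m' m' ℂ) (A : Matrix m m ℂ) :
    Φ A = ∑ i, ∑ j, A i j • Φ (Matrix.single i j 1) := by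
  conv_lhs => rw [Matrix.matrix_eq_sum_single A]
  simp only [map_sum, ← map_smul, Matrix.smul_single, smul_eq_mul, mul_one]

theorem tensor_kronecker {m n m' n' : Type*} [Fintype m] [Fintype n] [DecidableEq m]
    [DecidableEq n]
    (Φ : Matrix m m ℂ →ₗ[ℂ] Matrix m' m' ℂ) (Ψ : Matrix n n ℂ →ₗ[ℂ] Matrix n' n' ℂ)
    (A : Matrix m m ℂ) (B : Matrix n n ℂ) :
    tensor Φ Ψ (A ⊗ₖ B) = Φ A ⊗ₖ Ψ B := by
  ext ⟨a, b⟩ ⟨c, e⟩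
  rw [map_eq_sum Φ A, map_eq_sum Ψ B]
  simp only [tensor, LinearMap.coe_mk, AddHom.coe_mk, Matrix.sum_apply, Matrix.smul_apply,
    Matrix.kroneckerMap_apply, smul_eq_mul, Finset.sum_mul]
  refine Finset.sum_congr rfl fun i _ => Finset.sum_congr rfl fun j _ => ?_
  simp only [Finset.mul_sum]
  refine Finset.sum_congr rfl fun k _ => Finset.sum_congr rfl fun l _ => ?_
  ring

/-- The set of output entropies `S(Φ(ρ))`, with `ρ` ranging over all density matrices. -/
def outputEntropies {n n' : Type*} [Fintype n] [Fintype n'] [DecidableEq n']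
    (Φ : Matrix n n ℂ →ₗ[ℂ] Matrix n' n' ℂ) : Set ℝ :=
  {s | ∃ ρ : Matrix n n ℂ, IsDensityMatrix ρ ∧ s = vonNeumannEntropy (Φ ρ)}

/-- The minimum output entropy `h(Φ)`, as an infimum; that it is a minimum is the statement
`IsLeast (outputEntropies Φ) (minOutputEntropy Φ)`. -/
def minOutputEntropy {n n' : Type*} [Fintype n] [Fintype n'] [DecidableEq n']
    (Φ : Matrix n n ℂ →ₗ[ℂ] Matrix n' n' ℂ) : ℝ :=
  sInf (outputEntropies Φ)

/-- For a Hermitian matrix the entropy is `-∑ x log x` over its eigenvalues `x`. -/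
theorem vonNeumannEntropy_eq_sum {n : Type*} [Fintype n] [DecidableEq n] {σ : Matrix n n ℂ}
    (hσ : σ.IsHermitian) :
    vonNeumannEntropy σ = ∑ i, Real.negMulLog (hσ.eigenvalues i) := by
  have hc : ∀ f : ℝ → ℝ, ContinuousOn f (spectrum ℝ σ) := fun f =>
    (Matrix.finite_real_spectrum (A := σ)).continuousOn f
  have h1 : σ * cfc Real.log σ = cfc (fun x : ℝ => x * Real.log x) σ := by
    rw [cfc_mul (fun x : ℝ => x) Real.log σ (hc _) (hc _),
      cfc_id' ℝ σ hσ.isSelfAdjoint]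
  rw [vonNeumannEntropy, h1, hσ.cfc_eq, Matrix.IsHermitian.cfc, Unitary.conjStarAlgAut_apply,
    Matrix.trace_mul_cycle, Unitary.coe_star_mul_self, one_mul, Matrix.trace_diagonal]
  simp [Real.negMulLog, Function.comp]

end TransposeDepolarizing

end

/-!
Entropy is concave, so only pure input states matter. By the singular value decomposition
(`exists_singularValueDecomposition`) and the covariance of the channels under unitary conjugation
(`pureOutput_mul`), a pure input state can be replaced by one with real coefficients `s` in a product
basis, supported on a partial matching of the two bases. Write `p₀ = (1 - t₁) / d₁` and
`q₀ = (1 - t₂) / d₂`. In this basis the output is a diagonal matrix plus the rank-one matrix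
`t₁ t₂ s sᵀ`, and the diagonal entries depend linearly on the weights `s²` (`schmidtOutput`).
Product states correspond to a single weight equal to one, and their output has the eigenvalues of
a tensor product of two channel outputs. The claim becomes that the entropy of the output is at
least the average of these product values with weights `s²`; it is proved one basis vector at a
time (`sum_mul_sum_le_of_quadratic`).

A basis vector off the matching is an eigenvector of the output, with an eigenvalue linear in `s²`,
and concavity of `η(x) = -x log x` suffices. On the matching, `η` is bounded below, on the spectrum
of the output, by a parabola that agrees with `η` at the two values `c = p₀ q₀` and
`z = (p₀ + t₁) (q₀ + t₂)` taken on product states. The diagonal entries of a quadratic polynomial in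
the output are explicit, and the comparison reduces to the sign of
`m (m + 2 t₁ t₂)`, where `m = t₁ q₀ + p₀ t₂`.

For nonpositive parameters, not both zero, `z < c`, and the parabola touches `η` at `c`; it stays
below `η` on `[z, ∞)` (`exists_quadratic_minorant`), and the spectrum lies there by positivity of
the map `μ ↦ (tr μ) I - μ` tensored with itself (`wernerHolevo_quadraticForm_nonneg`). For
nonnegative parameters the parabola is the chord of `η` over `[c, z]`, which contains the spectrum.
-/

set_option linter.unusedSectionVars false

open scoped ComplexOrder Kronecker

namespace TransposeDepolarizing

/-! ### Entropy through the weights of the eigenvectors -/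

section Weights

variable {n : Type*} [Fintype n] [DecidableEq n]

/-- The weight `|⟨eᵢ, vₖ⟩|²` of the `k`-th eigenvector of a Hermitian matrix in the `i`-th
coordinate. These weights form a doubly stochastic matrix. -/
noncomputable def eigenWeight {σ : Matrix n n ℂ} (hσ : σ.IsHermitian) (i k : n) : ℝ :=
  Complex.normSq ((hσ.eigenvectorUnitary : Matrix n n ℂ) i k)

variable {σ : Matrix n n ℂ} (hσ : σ.IsHermitian)

theorem eigenWeight_nonneg (i k : n) : 0 ≤ eigenWeight hσ i k := Complex.normSq_nonneg _

theorem sum_normSq_row {U : Matrix n n ℂ} (hU : U ∈ Matrix.unitaryGroup n ℂ) (i : n) :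
    ∑ k, Complex.normSq (U i k) = 1 := by
  have h := congrFun (congrFun (Matrix.mem_unitaryGroup_iff.mp hU) i) i
  simp only [Matrix.mul_apply, Matrix.star_apply, Matrix.one_apply_eq, Complex.star_def,
    Complex.mul_conj] at h
  exact_mod_cast h

theorem sum_normSq_col {U : Matrix n n ℂ} (hU : U ∈ Matrix.unitaryGroup n ℂ) (k : n) :
    ∑ i, Complex.normSq (U i k) = 1 := by
  have h := congrFun (congrFun (Matrix.mem_unitaryGroup_iff'.mp hU) k) k
  simp only [Matrix.mul_apply, Matrix.star_apply, Matrix.one_apply_eq, Complex.star_def,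
    mul_comm, Complex.mul_conj] at h
  exact_mod_cast h

theorem sum_eigenWeight_row (i : n) : ∑ k, eigenWeight hσ i k = 1 :=
  sum_normSq_row hσ.eigenvectorUnitary.2 i

theorem sum_eigenWeight_col (k : n) : ∑ i, eigenWeight hσ i k = 1 :=
  sum_normSq_col hσ.eigenvectorUnitary.2 k

theorem eq_eigenvectorUnitary_mul_diagonal_mul :
    σ = (hσ.eigenvectorUnitary : Matrix n n ℂ) *
      Matrix.diagonal (fun k => (hσ.eigenvalues k : ℂ)) *
      star (hσ.eigenvectorUnitary : Matrix n n ℂ) := by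
  have h := hσ.spectral_theorem
  rw [Unitary.conjStarAlgAut_apply] at h
  exact h

theorem mul_eigenvectorUnitary :
    σ * (hσ.eigenvectorUnitary : Matrix n n ℂ) = (hσ.eigenvectorUnitary : Matrix n n ℂ) *
      Matrix.diagonal (fun k => (hσ.eigenvalues k : ℂ)) := by
  have h := congrArg (· * (hσ.eigenvectorUnitary : Matrix n n ℂ))
    (eq_eigenvectorUnitary_mul_diagonal_mul hσ)
  beta_reduce at h
  rwa [Matrix.mul_assoc _ (star _), Unitary.coe_star_mul_self, Matrix.mul_one] at h

theorem diag_conj_diagonal (E : Matrix n n ℂ) (μ : n → ℝ) (i : n) :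
    (E * Matrix.diagonal (fun k => (μ k : ℂ)) * star E) i i =
      ((∑ k, Complex.normSq (E i k) * μ k : ℝ) : ℂ) := by
  rw [Matrix.mul_apply]
  push_cast
  refine Finset.sum_congr rfl fun k _ => ?_
  rw [Matrix.mul_diagonal, Matrix.star_apply, Complex.star_def, mul_right_comm, Complex.mul_conj]

theorem sum_eigenWeight_mul_eigenvalues (i : n) :
    ∑ k, eigenWeight hσ i k * hσ.eigenvalues k = (σ i i).re := by
  conv_rhs => rw [eq_eigenvectorUnitary_mul_diagonal_mul hσ, diag_conj_diagonal]
  rw [Complex.ofReal_re]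
  rfl

theorem sum_eigenWeight_mul_eigenvalues_sq (i : n) :
    ∑ k, eigenWeight hσ i k * hσ.eigenvalues k ^ 2 = ((σ * σ) i i).re := by
  have h : σ * σ = (hσ.eigenvectorUnitary : Matrix n n ℂ) *
      Matrix.diagonal (fun k => ((hσ.eigenvalues k ^ 2 : ℝ) : ℂ)) *
      star (hσ.eigenvectorUnitary : Matrix n n ℂ) := by
    have h := congrArg (σ * ·) (eq_eigenvectorUnitary_mul_diagonal_mul hσ)
    beta_reduce at h
    rw [h, ← Matrix.mul_assoc, ← Matrix.mul_assoc,
      mul_eigenvectorUnitary, Matrix.mul_assoc _ (Matrix.diagonal _) (Matrix.diagonal _),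
      Matrix.diagonal_mul_diagonal]
    congr 3
    ext k
    push_cast
    ring
  rw [h, diag_conj_diagonal, Complex.ofReal_re]
  rfl

theorem vonNeumannEntropy_eq_sum_eigenWeight :
    vonNeumannEntropy σ = ∑ i, ∑ k, eigenWeight hσ i k * Real.negMulLog (hσ.eigenvalues k) := by
  rw [vonNeumannEntropy_eq_sum hσ, Finset.sum_comm]
  refine Finset.sum_congr rfl fun k _ => ?_
  rw [← Finset.sum_mul, sum_eigenWeight_col, one_mul]

/-- If the `i`-th row of `σ` vanishes off the diagonal, then only eigenvectors with eigenvalue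
`σ i i` have weight in the `i`-th coordinate. -/
theorem sum_eigenWeight_mul_of_row_eq {i : n} {a : ℝ}
    (hi : ∀ j, σ i j = if i = j then (a : ℂ) else 0) (f : ℝ → ℝ) :
    ∑ k, eigenWeight hσ i k * f (hσ.eigenvalues k) = f a := by
  rw [← one_mul (f a), ← sum_eigenWeight_row hσ i, Finset.sum_mul]
  refine Finset.sum_congr rfl fun k _ => ?_
  have h := congrFun (congrFun (mul_eigenvectorUnitary hσ) i) k
  rw [Matrix.mul_diagonal, Matrix.mul_apply] at h
  simp only [hi, ite_mul, zero_mul, Finset.sum_ite_eq, Finset.mem_univ, if_true] at h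
  rcases eq_or_ne ((hσ.eigenvectorUnitary : Matrix n n ℂ) i k) 0 with h0 | h0
  · simp only [eigenWeight, h0, Complex.normSq_zero, zero_mul]
  · rw [mul_comm] at h
    have := mul_left_cancel₀ h0 h
    rw [Complex.ofReal_inj.mp this]

theorem vonNeumannEntropy_diagonal (p : n → ℝ) :
    vonNeumannEntropy (Matrix.diagonal fun i => (p i : ℂ)) = ∑ i, Real.negMulLog (p i) := by
  have hσ : (Matrix.diagonal fun i => (p i : ℂ)).IsHermitian :=
    Matrix.isHermitian_diagonal_of_self_adjoint _ (by
      ext i; simp)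
  rw [vonNeumannEntropy_eq_sum_eigenWeight hσ]
  refine Finset.sum_congr rfl fun i _ => ?_
  exact sum_eigenWeight_mul_of_row_eq hσ (fun j => by simp [Matrix.diagonal_apply]) _

/-- Pinching to the diagonal does not decrease the entropy. -/
theorem vonNeumannEntropy_le_sum_diag (h : σ.PosSemidef) :
    vonNeumannEntropy σ ≤ ∑ i, Real.negMulLog (σ i i).re := by
  rw [vonNeumannEntropy_eq_sum_eigenWeight h.1]
  refine Finset.sum_le_sum fun i _ => ?_
  rw [← sum_eigenWeight_mul_eigenvalues h.1 i]
  have := Real.concaveOn_negMulLog.le_map_sum (t := Finset.univ)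
    (fun k _ => eigenWeight_nonneg h.1 i k) (sum_eigenWeight_row h.1 i)
    (fun k _ => h.eigenvalues_nonneg k)
  simpa only [smul_eq_mul] using this

theorem vonNeumannEntropy_conj {U : Matrix n n ℂ} (hU : U ∈ Matrix.unitaryGroup n ℂ)
    (hσ : σ.IsHermitian) : vonNeumannEntropy (U * σ * star U) = vonNeumannEntropy σ := by
  have hc : ∀ f : ℝ → ℝ, ContinuousOn f (spectrum ℝ σ) := fun f =>
    (Matrix.finite_real_spectrum (A := σ)).continuousOn f
  let φ := Unitary.conjStarAlgAut ℝ (Matrix n n ℂ) ⟨U, hU⟩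
  have hφ : ∀ A, φ A = U * A * star U := fun A => rfl
  have hcont : Continuous φ := by
    show Continuous fun A : Matrix n n ℂ => U * A * star U
    fun_prop
  have h : cfc Real.log (φ σ) = φ (cfc Real.log σ) := by
    refine (StarAlgHomClass.map_cfc φ Real.log σ (hc _) hcont hσ.isSelfAdjoint ?_).symm
    rw [hφ]
    exact Matrix.isHermitian_mul_mul_conjTranspose U hσ
  rw [← hφ, vonNeumannEntropy, h, ← map_mul, hφ, Matrix.trace_mul_cycle,
    Matrix.mem_unitaryGroup_iff'.mp hU, Matrix.one_mul, vonNeumannEntropy]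

/-- Concavity of the von Neumann entropy. -/
theorem sum_mul_vonNeumannEntropy_le {ι : Type*} [Fintype ι] (p : ι → ℝ) (hp : ∀ i, 0 ≤ p i)
    (hp1 : ∑ i, p i = 1) (τ : ι → Matrix n n ℂ) (hτ : ∀ i, (τ i).PosSemidef) :
    ∑ i, p i * vonNeumannEntropy (τ i) ≤ vonNeumannEntropy (∑ i, (p i : ℂ) • τ i) := by
  have hs : (∑ i, (p i : ℂ) • τ i).IsHermitian :=
    (Matrix.posSemidef_sum _ fun i _ => (hτ i).smul (by exact_mod_cast hp i)).1
  set E : Matrix n n ℂ := (hs.eigenvectorUnitary : Matrix n n ℂ) with hE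
  have hEu : star E ∈ Matrix.unitaryGroup n ℂ :=
    Unitary.star_mem hs.eigenvectorUnitary.2
  have hpos : ∀ i, (star E * τ i * star (star E)).PosSemidef := fun i =>
    (hτ i).mul_mul_conjTranspose_same (star E)
  -- In the eigenbasis of the average, its eigenvalues are averages of the diagonal entries.
  have hev : ∀ k, hs.eigenvalues k = ∑ i, p i * ((star E * τ i * star (star E)) k k).re := by
    intro k
    have h : star E * (∑ i, (p i : ℂ) • τ i) * star (star E) =
        Matrix.diagonal fun k => (hs.eigenvalues k : ℂ) := by
      rw [star_star, Matrix.mul_assoc, mul_eigenvectorUnitary hs, ← Matrix.mul_assoc,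
        Unitary.coe_star_mul_self, Matrix.one_mul]
    have h2 := congrArg Complex.re (congrFun (congrFun h k) k)
    rw [Matrix.diagonal_apply_eq, Complex.ofReal_re] at h2
    rw [← h2, Finset.mul_sum, Finset.sum_mul, Matrix.sum_apply, Complex.re_sum]
    refine Finset.sum_congr rfl fun i _ => ?_
    rw [Matrix.mul_smul, Matrix.smul_mul, Matrix.smul_apply, smul_eq_mul, Complex.re_ofReal_mul]
  rw [vonNeumannEntropy_eq_sum hs]
  calc ∑ i, p i * vonNeumannEntropy (τ i)
      ≤ ∑ i, p i * ∑ k, Real.negMulLog ((star E * τ i * star (star E)) k k).re := by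
        refine Finset.sum_le_sum fun i _ => mul_le_mul_of_nonneg_left ?_ (hp i)
        rw [← vonNeumannEntropy_conj hEu (hτ i).1]
        exact vonNeumannEntropy_le_sum_diag (hpos i)
    _ = ∑ k, ∑ i, p i * Real.negMulLog ((star E * τ i * star (star E)) k k).re := by
        simp only [Finset.mul_sum]
        exact Finset.sum_comm
    _ ≤ ∑ k, Real.negMulLog (hs.eigenvalues k) := by
        refine Finset.sum_le_sum fun k _ => ?_
        rw [hev k]
        have := Real.concaveOn_negMulLog.le_map_sum (t := Finset.univ)
          (fun i _ => hp i) hp1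
          (fun i _ => (Complex.le_def.mp ((hpos i).diag_nonneg (i := k))).1)
        simpa only [smul_eq_mul] using! this

end Weights

/-! ### Quadratic minorants of `-x log x` -/

section Minorant

open Real

/-- Equivalently, the parabola touching `-x log x` at `1` and meeting it at `z` has leading
coefficient at most `-1/2`. -/
theorem half_one_sub_sq_le {z : ℝ} (hz0 : 0 ≤ z) (hz1 : z ≤ 1) :
    (1 - z) ^ 2 / 2 ≤ 1 - z - negMulLog z := by
  have hanti : AntitoneOn (fun y : ℝ => 1 - y - negMulLog y - (1 - y) ^ 2 / 2) (Set.Icc 0 1) := by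
    refine antitoneOn_of_deriv_nonpos (convex_Icc 0 1) (by fun_prop) ?_ ?_
    · intro y hy
      rw [interior_Icc] at hy
      have := (hasDerivAt_negMulLog hy.1.ne').differentiableAt
      exact (((differentiableAt_const _).sub differentiableAt_id).sub this |>.sub
        (by fun_prop)).differentiableWithinAt
    · intro y hy
      rw [interior_Icc] at hy
      have h : HasDerivAt (fun y : ℝ => 1 - y - negMulLog y - (1 - y) ^ 2 / 2)
          (0 - 1 - (-log y - 1) - (2 * (1 - y) ^ 1 * (0 - 1)) / 2) y := by
        refine (((hasDerivAt_const y (1 : ℝ)).sub (hasDerivAt_id y)).sub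
          (hasDerivAt_negMulLog hy.1.ne')).sub ((HasDerivAt.pow
          ((hasDerivAt_const y (1 : ℝ)).sub (hasDerivAt_id y)) 2).div_const 2)
      rw [h.deriv]
      have := log_le_sub_one_of_pos hy.1
      linarith
  have := hanti ⟨hz0, hz1⟩ (Set.right_mem_Icc.mpr zero_le_one) hz1
  simp at this
  linarith

/-- The parabola through `(z, -z log z)` that touches `-x log x` at `1` stays below `-x log x` to
the right of `z`: the difference is concave up to the point `b` where its second derivative
vanishes, decreasing from `b` to `1` and increasing afterwards. -/
theorem one_sub_sub_le_negMulLog {z x : ℝ} (hz0 : 0 ≤ z) (hz1 : z < 1) (hx : z ≤ x) :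
    1 - x - (1 - z - negMulLog z) / (1 - z) ^ 2 * (1 - x) ^ 2 ≤ negMulLog x := by
  set κ := (1 - z - negMulLog z) / (1 - z) ^ 2 with hκ
  have hz : 0 < (1 - z) ^ 2 := by nlinarith
  have hκ2 : 1 / 2 ≤ κ := by
    rw [hκ, le_div_iff₀ hz]
    linarith [half_one_sub_sq_le hz0 hz1.le]
  have hκz : κ * (1 - z) ^ 2 = 1 - z - negMulLog z := div_mul_cancel₀ _ hz.ne'
  set g : ℝ → ℝ := fun y => negMulLog y - (1 - y) + κ * (1 - y) ^ 2 with hg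
  have hgc : Continuous g := by fun_prop
  have hder : ∀ y, 0 < y → HasDerivAt g (-log y + 2 * κ * (y - 1)) y := by
    intro y hy
    have h : HasDerivAt g ((-log y - 1) - (0 - 1) + κ * (2 * (1 - y) ^ 1 * (0 - 1))) y :=
      ((hasDerivAt_negMulLog hy.ne').sub ((hasDerivAt_const y (1 : ℝ)).sub (hasDerivAt_id y))).add
        ((HasDerivAt.pow ((hasDerivAt_const y (1 : ℝ)).sub (hasDerivAt_id y)) 2).const_mul κ)
    convert h using 1
    ring
  have hg1 : g 1 = 0 := by simp [hg]
  have hgz : g z = 0 := by simp only [hg]; linarith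
  suffices h : 0 ≤ g x by
    simp only [hg] at h
    linarith
  set b := 1 / (2 * κ) with hb
  have hb0 : 0 < b := by positivity
  have hb1 : b ≤ 1 := by
    rw [hb, div_le_one (by linarith)]
    linarith
  have hbκ : 2 * κ * b = 1 := by
    rw [hb]
    field_simp
  have hmid : ∀ y, b ≤ y → y ≤ 1 → 0 ≤ g y := by
    intro y hby hy1
    have hanti : AntitoneOn g (Set.Icc b 1) := by
      refine antitoneOn_of_deriv_nonpos (convex_Icc b 1) hgc.continuousOn
        (fun w hw => ?_) (fun w hw => ?_)
      all_goals
        rw [interior_Icc] at hw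
        have hw0 : 0 < w := hb0.trans hw.1
      · exact (hder w hw0).differentiableAt.differentiableWithinAt
      · rw [(hder w hw0).deriv]
        have h1 := one_sub_inv_le_log_of_pos hw0
        have h2 : w⁻¹ - 1 ≤ 2 * κ * (1 - w) := by
          have : w⁻¹ - 1 = w⁻¹ * (1 - w) := by field_simp
          rw [this]
          refine mul_le_mul_of_nonneg_right ?_ (by linarith [hw.2])
          rw [inv_le_iff_one_le_mul₀ hw0]
          nlinarith [hw.1]
        linarith
    rw [← hg1]
    exact hanti ⟨hby, hy1⟩ (Set.right_mem_Icc.mpr hb1) hy1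
  rcases le_total 1 x with h1 | h1
  · have hmono : MonotoneOn g (Set.Ici 1) := by
      refine monotoneOn_of_deriv_nonneg (convex_Ici 1) hgc.continuousOn
        (fun w hw => ?_) (fun w hw => ?_)
      all_goals
        rw [interior_Ici] at hw
        have hw1 : 1 < w := hw
        have hw0 : 0 < w := zero_lt_one.trans hw1
      · exact (hder w hw0).differentiableAt.differentiableWithinAt
      · rw [(hder w hw0).deriv]
        have := log_le_sub_one_of_pos hw0
        nlinarith
    rw [← hg1]
    exact hmono (Set.mem_Ici.mpr le_rfl) h1 h1
  rcases le_total b x with h2 | h2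
  · exact hmid x h2 h1
  · have hconc : ConcaveOn ℝ (Set.Icc 0 b) g := by
      refine AntitoneOn.concaveOn_of_deriv (convex_Icc 0 b) hgc.continuousOn
        (fun w hw => ?_) (fun w hw w' hw' hww => ?_)
      · rw [interior_Icc] at hw
        exact (hder w hw.1).differentiableAt.differentiableWithinAt
      · rw [interior_Icc] at hw hw'
        rw [(hder w hw.1).deriv, (hder w' hw'.1).deriv]
        have h3 := one_sub_inv_le_log_of_pos (div_pos hw'.1 hw.1)
        rw [log_div hw'.1.ne' hw.1.ne', inv_div] at h3
        have h4 : 2 * κ * (w' - w) ≤ 1 - w / w' := by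
          have : 1 - w / w' = w'⁻¹ * (w' - w) := by
            have := hw'.1.ne'
            field_simp
          rw [this]
          refine mul_le_mul_of_nonneg_right ?_ (by linarith)
          rw [le_inv_comm₀ (by linarith) hw'.1]
          rw [hb, one_div] at hw'
          exact hw'.2.le
        linarith
    have := hconc.min_le_of_mem_Icc ⟨hz0, hx.trans h2⟩ (Set.right_mem_Icc.mpr hb0.le) ⟨hx, h2⟩
    exact (le_min hgz.ge (hmid b le_rfl hb1)).trans this

/-- For `0 ≤ z < c`, the concave parabola that touches `-x log x` at `c` and meets it again at `z`
lies below `-x log x` on `[z, ∞)`. -/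
theorem exists_quadratic_minorant {c z : ℝ} (hz0 : 0 ≤ z) (hzc : z < c) :
    ∃ β γ : ℝ, 0 ≤ γ ∧
      negMulLog z = negMulLog c + β * (z - c) - γ * (z - c) ^ 2 ∧
      ∀ x, z ≤ x → negMulLog c + β * (x - c) - γ * (x - c) ^ 2 ≤ negMulLog x := by
  have hc : 0 < c := hz0.trans_lt hzc
  have hw0 : 0 ≤ z / c := div_nonneg hz0 hc.le
  have hw1 : z / c < 1 := (div_lt_one hc).mpr hzc
  -- Rescaling by `c` reduces to the parabola touching at `1`.
  have hscale : ∀ x, negMulLog x = c * negMulLog (x / c) + x / c * negMulLog c := by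
    intro x
    rw [← negMulLog_mul, div_mul_cancel₀ x hc.ne']
  set κ := (1 - z / c - negMulLog (z / c)) / (1 - z / c) ^ 2 with hκ
  have hz : 0 < (1 - z / c) ^ 2 := by nlinarith
  have hκz : κ * (1 - z / c) ^ 2 = 1 - z / c - negMulLog (z / c) := div_mul_cancel₀ _ hz.ne'
  have hexp : ∀ x, negMulLog c + (negMulLog c / c - 1) * (x - c) - κ / c * (x - c) ^ 2 =
      c * (1 - x / c - κ * (1 - x / c) ^ 2) + x / c * negMulLog c := by
    intro x
    field_simp
    ring
  refine ⟨negMulLog c / c - 1, κ / c, ?_, ?_, fun x hx => ?_⟩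
  · refine div_nonneg (div_nonneg ?_ hz.le) hc.le
    linarith [half_one_sub_sq_le hw0 hw1.le]
  · rw [hexp, hscale z, hκz]
    ring
  · rw [hexp, hscale x]
    have := mul_le_mul_of_nonneg_left (one_sub_sub_le_negMulLog hw0 hw1
      (div_le_div_of_nonneg_right hx hc.le)) hc.le
    linarith

/-- For `0 ≤ c ≤ z`, the chord of `-x log x` over `[c, z]` lies below it. -/
theorem exists_chord_minorant {c z : ℝ} (hc0 : 0 ≤ c) (hcz : c ≤ z) :
    ∃ β : ℝ, negMulLog z = negMulLog c + β * (z - c) ∧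
      ∀ x, c ≤ x → x ≤ z → negMulLog c + β * (x - c) ≤ negMulLog x := by
  rcases hcz.eq_or_lt with rfl | hlt
  · exact ⟨0, by simp, fun x h1 h2 => by rw [le_antisymm h2 h1]; simp⟩
  have hpos : 0 < z - c := sub_pos.mpr hlt
  refine ⟨(negMulLog z - negMulLog c) / (z - c), ?_, fun x h1 h2 => ?_⟩
  · field_simp
    ring
  · have := concaveOn_negMulLog.2 (Set.mem_Ici.mpr hc0) (Set.mem_Ici.mpr (hc0.trans hcz))
      (show 0 ≤ (z - x) / (z - c) from div_nonneg (by linarith) hpos.le)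
      (show 0 ≤ (x - c) / (z - c) from div_nonneg (by linarith) hpos.le)
      (by field_simp; ring)
    have hx : ((z - x) / (z - c)) • c + ((x - c) / (z - c)) • z = x := by
      simp only [smul_eq_mul]
      field_simp
      ring
    rw [hx] at this
    refine le_trans (le_of_eq ?_) this
    simp only [smul_eq_mul]
    field_simp
    ring

end Minorant

/-! ### Singular value decomposition -/

section SingularValues

variable {m n : Type*} [Fintype m] [DecidableEq m] [Fintype n] [DecidableEq n]

/-- A real function on pairs is a partial matching if its support meets every row and every column
at most once. -/
def IsPartialMatching {m n : Type*} (s : m × n → ℝ) : Prop :=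
  ∀ p p' : m × n, s p ≠ 0 → s p' ≠ 0 → p.1 = p'.1 ∨ p.2 = p'.2 → p = p'

/-- The nonzero columns of `B`, normalized, extend to an orthonormal basis, which gives `U`. -/
theorem exists_unitary_mul_eq_of_orthogonal_columns {B : Matrix m n ℂ} {μ : n → ℝ}
    (e : n ↪ m) (hμ : ∀ k, 0 ≤ μ k)
    (hB : B.conjTranspose * B = Matrix.diagonal fun k => (μ k : ℂ)) :
    ∃ U ∈ Matrix.unitaryGroup m ℂ,
      B = U * Matrix.of fun j k => ((if j = e k then √(μ k) else 0 : ℝ) : ℂ) := by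
  let b : n → EuclideanSpace ℂ m := fun k => WithLp.toLp 2 fun i => B i k
  have hb : ∀ k l, inner ℂ (b k) (b l) = if k = l then (μ k : ℂ) else 0 := by
    intro k l
    have h := congrFun (congrFun hB k) l
    rw [Matrix.diagonal_apply] at h
    rw [← h, Matrix.mul_apply, PiLp.inner_apply]
    simp [b, Matrix.conjTranspose_apply, mul_comm]
  let v : m → EuclideanSpace ℂ m := Function.extend e (fun k => ((√(μ k))⁻¹ : ℂ) • b k) 0
  have hve : ∀ k, v (e k) = ((√(μ k))⁻¹ : ℂ) • b k := fun k => e.injective.extend_apply _ _ k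
  let S : Set m := e '' {k | μ k ≠ 0}
  have hsq : ∀ k, (√(μ k) : ℂ) * (√(μ k) : ℂ) = μ k := fun k => by
    exact_mod_cast Real.mul_self_sqrt (hμ k)
  have hon : Orthonormal ℂ (S.domRestrict v) := by
    rw [orthonormal_iff_ite]
    rintro ⟨_, k, hk, rfl⟩ ⟨_, l, hl, rfl⟩
    have hk' : (√(μ k) : ℂ) ≠ 0 := by
      exact_mod_cast (Real.sqrt_pos.mpr (lt_of_le_of_ne (hμ k) (Ne.symm hk))).ne'
    simp only [Set.domRestrict_apply, hve, inner_smul_left, inner_smul_right, hb]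
    rcases eq_or_ne k l with h | h
    · subst h
      rw [if_pos rfl, if_pos rfl, ← hsq k, map_inv₀, Complex.conj_ofReal]
      field_simp
    · rw [if_neg h, mul_zero, mul_zero]
      symm
      exact if_neg fun h' => h (e.injective (congrArg Subtype.val h'))
  obtain ⟨f, hf⟩ := hon.exists_orthonormalBasis_extension_of_card_eq (by simp)
  let U : Matrix m m ℂ := Matrix.of fun i j => f j i
  have hU : U ∈ Matrix.unitaryGroup m ℂ := by
    rw [Matrix.mem_unitaryGroup_iff']
    ext j l
    have h := orthonormal_iff_ite.mp f.orthonormal j l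
    rw [Matrix.one_apply, ← h, Matrix.mul_apply, PiLp.inner_apply]
    simp [U, Matrix.star_apply, mul_comm]
  refine ⟨U, hU, ?_⟩
  ext i k
  have h1 : (U * Matrix.of fun j k => ((if j = e k then √(μ k) else 0 : ℝ) : ℂ)) i k =
      f (e k) i * (√(μ k) : ℂ) := by
    rw [Matrix.mul_apply, Finset.sum_eq_single (e k)]
    · simp [U]
    · intro j _ hj
      simp [hj]
    · simp
  rw [h1]
  by_cases hk : μ k = 0
  · have h0 : b k = 0 := by
      rw [← inner_self_eq_zero (𝕜 := ℂ), hb]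
      simp [hk]
    have h2 : b k i = 0 := by rw [h0]; rfl
    rw [hk, Real.sqrt_zero, Complex.ofReal_zero, mul_zero]
    exact h2
  · have hk' : (√(μ k) : ℂ) ≠ 0 := by
      exact_mod_cast (Real.sqrt_pos.mpr (lt_of_le_of_ne (hμ k) (Ne.symm hk))).ne'
    rw [hf (e k) ⟨k, hk, rfl⟩, hve]
    show B i k = ((√(μ k))⁻¹ : ℂ) * B i k * (√(μ k) : ℂ)
    field_simp

theorem exists_singularValueDecomposition_of_card_le (hc : Fintype.card n ≤ Fintype.card m)
    (A : Matrix m n ℂ) :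
    ∃ U ∈ Matrix.unitaryGroup m ℂ, ∃ V ∈ Matrix.unitaryGroup n ℂ, ∃ s : m × n → ℝ,
      IsPartialMatching s ∧ A = U * (Matrix.of fun j k => (s (j, k) : ℂ)) * V.transpose := by
  obtain ⟨e⟩ := Function.Embedding.nonempty_of_card_le hc
  have hA : (A.conjTranspose * A).PosSemidef := Matrix.posSemidef_conjTranspose_mul_self A
  set E : Matrix n n ℂ := (hA.1.eigenvectorUnitary : Matrix n n ℂ) with hE
  have hEu : E ∈ Matrix.unitaryGroup n ℂ := hA.1.eigenvectorUnitary.2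
  have hB : (A * E).conjTranspose * (A * E) = Matrix.diagonal fun k => (hA.1.eigenvalues k : ℂ) := by
    have h := mul_eigenvectorUnitary hA.1
    rw [← hE] at h
    rw [Matrix.conjTranspose_mul, Matrix.mul_assoc, ← Matrix.mul_assoc _ A, h, ← Matrix.mul_assoc,
      ← Matrix.star_eq_conjTranspose, Matrix.mem_unitaryGroup_iff'.mp hEu, Matrix.one_mul]
  obtain ⟨U, hU, h⟩ := exists_unitary_mul_eq_of_orthogonal_columns e hA.eigenvalues_nonneg hB
  refine ⟨U, hU, E.map star, Matrix.map_star_mem_unitaryGroup_iff.mpr hEu,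
    fun p => if p.1 = e p.2 then √(hA.1.eigenvalues p.2) else 0, ?_, ?_⟩
  · rintro ⟨j, k⟩ ⟨j', k'⟩ h1 h2 h3
    simp only [ne_eq, ite_eq_right_iff, Classical.not_imp] at h1 h2
    have h4 : k = k' := by
      rcases h3 with h3 | h3
      · exact e.injective (h1.1.symm.trans (h3.trans h2.1))
      · exact h3
    subst h4
    rw [h1.1, h2.1]
  · have h5 : (E.map star).transpose = star E := rfl
    rw [h5, ← h, Matrix.mul_assoc, Matrix.mem_unitaryGroup_iff.mp hEu, Matrix.mul_one]

/-- Singular value decomposition of a rectangular complex matrix. -/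
theorem exists_singularValueDecomposition (A : Matrix m n ℂ) :
    ∃ U ∈ Matrix.unitaryGroup m ℂ, ∃ V ∈ Matrix.unitaryGroup n ℂ, ∃ s : m × n → ℝ,
      IsPartialMatching s ∧ A = U * (Matrix.of fun j k => (s (j, k) : ℂ)) * V.transpose := by
  rcases le_total (Fintype.card n) (Fintype.card m) with hc | hc
  · exact exists_singularValueDecomposition_of_card_le hc A
  · obtain ⟨U, hU, V, hV, s, hs, h⟩ := exists_singularValueDecomposition_of_card_le hc A.transpose
    refine ⟨V, hV, U, hU, fun p => s p.swap, fun p p' h1 h2 h3 => ?_, ?_⟩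
    · exact Prod.swap_injective (hs _ _ h1 h2 h3.symm)
    · rw [← Matrix.transpose_transpose A, h, Matrix.transpose_mul, Matrix.transpose_mul,
        Matrix.transpose_transpose, Matrix.mul_assoc]
      rfl

end SingularValues

/-! ### Rank-one perturbations of real diagonal matrices -/

section RankOne

variable {ι : Type*} [Fintype ι] [DecidableEq ι]

/-- The matrix `diag(D) + κ s sᵀ` for real data `D`, `s`, `κ`. -/
noncomputable def diagAddRankOne (D s : ι → ℝ) (κ : ℝ) : Matrix ι ι ℂ :=
  Matrix.of fun p p' => (((if p = p' then D p else 0) + κ * (s p * s p') : ℝ) : ℂ)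

theorem diagAddRankOne_apply (D s : ι → ℝ) (κ : ℝ) (p p' : ι) :
    diagAddRankOne D s κ p p' = (((if p = p' then D p else 0) + κ * (s p * s p') : ℝ) : ℂ) := rfl

theorem isHermitian_diagAddRankOne (D s : ι → ℝ) (κ : ℝ) :
    (diagAddRankOne D s κ).IsHermitian := by
  ext p p'
  rw [Matrix.conjTranspose_apply, diagAddRankOne_apply, diagAddRankOne_apply, Complex.star_def,
    Complex.conj_ofReal, mul_comm (s p')]
  rcases eq_or_ne p p' with h | h
  · rw [h]
  · rw [if_neg h, if_neg h.symm]

theorem diagAddRankOne_mul_self_apply (D s : ι → ℝ) (κ : ℝ) (hs : ∑ p, s p ^ 2 = 1) (p : ι) :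
    ((diagAddRankOne D s κ * diagAddRankOne D s κ) p p).re =
      D p ^ 2 + 2 * D p * κ * s p ^ 2 + κ ^ 2 * s p ^ 2 := by
  have h : ∀ p', diagAddRankOne D s κ p p' * diagAddRankOne D s κ p' p =
      (((if p = p' then D p ^ 2 + 2 * D p * κ * s p ^ 2 else 0) +
        κ ^ 2 * s p ^ 2 * s p' ^ 2 : ℝ) : ℂ) := by
    intro p'
    rw [diagAddRankOne_apply, diagAddRankOne_apply, ← Complex.ofReal_mul]
    congr 1
    rcases eq_or_ne p p' with h | h
    · subst h
      simp only [if_true]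
      ring
    · rw [if_neg h, if_neg h.symm, if_neg h]
      ring
  rw [Matrix.mul_apply, Finset.sum_congr rfl fun p' _ => h p', ← Complex.ofReal_sum,
    Complex.ofReal_re, Finset.sum_add_distrib, ← Finset.mul_sum, hs]
  simp

/-- An eigenvalue is the value of the quadratic form at its unit eigenvector. -/
theorem eigenvalues_diagAddRankOne (D s : ι → ℝ) (κ : ℝ)
    (h : (diagAddRankOne D s κ).IsHermitian) (k : ι) :
    h.eigenvalues k = ∑ p, D p * eigenWeight h p k +
      κ * Complex.normSq (∑ p, (s p : ℂ) * (h.eigenvectorUnitary : Matrix ι ι ℂ) p k) := by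
  set E : Matrix ι ι ℂ := (h.eigenvectorUnitary : Matrix ι ι ℂ) with hE
  have hrow : ∀ p, (D p : ℂ) * E p k + κ * (s p * ∑ p', (s p' : ℂ) * E p' k) =
      E p k * h.eigenvalues k := by
    intro p
    have h1 := congrFun (congrFun (mul_eigenvectorUnitary h) p) k
    rw [Matrix.mul_diagonal, Matrix.mul_apply, ← hE] at h1
    rw [← h1]
    simp only [diagAddRankOne_apply, Complex.ofReal_add, add_mul, Finset.sum_add_distrib,
      Complex.ofReal_mul, Finset.mul_sum]
    congr 1
    · rw [Finset.sum_eq_single p]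
      · simp
      · intro p' _ hp
        simp [hp.symm]
      · simp
    · exact Finset.sum_congr rfl fun p' _ => by ring
  have hsum : ∑ p, star (E p k) * ((D p : ℂ) * E p k + κ * (s p * ∑ p', (s p' : ℂ) * E p' k)) =
      h.eigenvalues k := by
    have h2 : ∀ p, star (E p k) * (E p k * h.eigenvalues k) =
        ((eigenWeight h p k * h.eigenvalues k : ℝ) : ℂ) := by
      intro p
      rw [Complex.ofReal_mul, eigenWeight, ← Complex.mul_conj, Complex.star_def]
      ring
    rw [Finset.sum_congr rfl fun p _ => by rw [hrow p, h2 p], ← Complex.ofReal_sum,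
      ← Finset.sum_mul, sum_eigenWeight_col, one_mul]
  have h3 : ∑ p, star (E p k) * ((D p : ℂ) * E p k + κ * (s p * ∑ p', (s p' : ℂ) * E p' k)) =
      ((∑ p, D p * eigenWeight h p k +
        κ * Complex.normSq (∑ p, (s p : ℂ) * E p k) : ℝ) : ℂ) := by
    rw [Complex.ofReal_add, Complex.ofReal_mul, ← Complex.mul_conj, map_sum, Finset.mul_sum,
      Finset.mul_sum, Complex.ofReal_sum, ← Finset.sum_add_distrib]
    refine Finset.sum_congr rfl fun p _ => ?_
    rw [Complex.ofReal_mul, eigenWeight, ← Complex.mul_conj, Complex.star_def, map_mul,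
      Complex.conj_ofReal]
    ring
  exact_mod_cast hsum.symm.trans h3

/-- The eigenvalues of a real symmetric matrix are bounded through its quadratic form on real
vectors; the real and imaginary parts of an eigenvector are treated separately. -/
theorem le_eigenvalues_diagAddRankOne {D s : ι → ℝ} {κ z : ℝ}
    (hz : ∀ f : ι → ℝ, z * ∑ p, f p ^ 2 ≤ ∑ p, D p * f p ^ 2 + κ * (∑ p, s p * f p) ^ 2)
    (h : (diagAddRankOne D s κ).IsHermitian) (k : ι) : z ≤ h.eigenvalues k := by
  have h1 := hz fun p => ((h.eigenvectorUnitary : Matrix ι ι ℂ) p k).re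
  have h2 := hz fun p => ((h.eigenvectorUnitary : Matrix ι ι ℂ) p k).im
  have h3 := sum_eigenWeight_col h k
  rw [eigenvalues_diagAddRankOne]
  simp only [eigenWeight, Complex.normSq_apply, Complex.re_sum, Complex.im_sum,
    Complex.re_ofReal_mul, Complex.im_ofReal_mul, mul_add, Finset.sum_add_distrib, ← pow_two]
    at h3 ⊢
  have h4 := congrArg (z * ·) h3
  simp only [mul_add, mul_one] at h4
  linarith

theorem eigenvalues_diagAddRankOne_le {D s : ι → ℝ} {κ z : ℝ}
    (hz : ∀ f : ι → ℝ, ∑ p, D p * f p ^ 2 + κ * (∑ p, s p * f p) ^ 2 ≤ z * ∑ p, f p ^ 2)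
    (h : (diagAddRankOne D s κ).IsHermitian) (k : ι) : h.eigenvalues k ≤ z := by
  have h1 := hz fun p => ((h.eigenvectorUnitary : Matrix ι ι ℂ) p k).re
  have h2 := hz fun p => ((h.eigenvectorUnitary : Matrix ι ι ℂ) p k).im
  have h3 := sum_eigenWeight_col h k
  rw [eigenvalues_diagAddRankOne]
  simp only [eigenWeight, Complex.normSq_apply, Complex.re_sum, Complex.im_sum,
    Complex.re_ofReal_mul, Complex.im_ofReal_mul, mul_add, Finset.sum_add_distrib, ← pow_two]
    at h3 ⊢
  have h4 := congrArg (z * ·) h3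
  simp only [mul_add, mul_one] at h4
  linarith

/-- For a unit vector `s`, expanding `∑ (s' f + s f')² ≥ ∑ (2 s f)²`, where the right side
collects the diagonal terms of the double sum on the left. -/
theorem two_mul_sum_sq_mul_sq_le {ι : Type*} [Fintype ι] (s f : ι → ℝ) (h1 : ∑ p, s p ^ 2 = 1) :
    2 * ∑ p, s p ^ 2 * f p ^ 2 ≤ ∑ p, f p ^ 2 + (∑ p, s p * f p) ^ 2 := by
  have hdiag : ∑ p, (s p * f p + s p * f p) ^ 2 ≤ ∑ p, ∑ p', (s p' * f p + s p * f p') ^ 2 :=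
    Finset.sum_le_sum fun p _ => Finset.single_le_sum
      (f := fun p' => (s p' * f p + s p * f p') ^ 2) (fun p' _ => sq_nonneg _) (Finset.mem_univ p)
  have hexp : ∑ p, ∑ p', (s p' * f p + s p * f p') ^ 2 =
      2 * ((∑ p, s p ^ 2) * ∑ p, f p ^ 2) + 2 * (∑ p, s p * f p) ^ 2 := by
    have h : ∀ p p', (s p' * f p + s p * f p') ^ 2 =
        f p ^ 2 * s p' ^ 2 + s p ^ 2 * f p' ^ 2 + 2 * ((s p * f p) * (s p' * f p')) :=
      fun p p' => by ring
    simp only [h, Finset.sum_add_distrib, ← Finset.mul_sum, ← Finset.sum_mul]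
    ring
  have h4 : ∑ p, (s p * f p + s p * f p) ^ 2 = 4 * ∑ p, s p ^ 2 * f p ^ 2 := by
    rw [Finset.mul_sum]
    exact Finset.sum_congr rfl fun p _ => by ring
  rw [hexp, h4, h1] at hdiag
  linarith

end RankOne

/-! ### Entropy of the output in Schmidt coordinates -/

section Schmidt

variable {m n : Type*} [Fintype m] [DecidableEq m] [Fintype n] [DecidableEq n]

/-- The first marginal of the weights `s²`, as a function on pairs. -/
noncomputable def rowWeight (s : m × n → ℝ) (p : m × n) : ℝ :=
  ∑ i, if p.1 = i.1 then s i ^ 2 else 0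

/-- The second marginal of the weights `s²`, as a function on pairs. -/
noncomputable def colWeight (s : m × n → ℝ) (p : m × n) : ℝ :=
  ∑ i, if p.2 = i.2 then s i ^ 2 else 0

/-- The output of the tensor product of two depolarizing channels on a pure state with Schmidt
coefficients `s`, in the Schmidt basis. Here `t₁`, `t₂` are the channel parameters, and `p₀`, `q₀`
are the coefficients `(1 - tᵢ) / dᵢ` of the unit matrices. -/
noncomputable def schmidtOutput (p₀ t₁ q₀ t₂ : ℝ) (s : m × n → ℝ) : Matrix (m × n) (m × n) ℂ :=
  diagAddRankOne (fun p => p₀ * q₀ + t₁ * q₀ * rowWeight s p + p₀ * t₂ * colWeight s p) s (t₁ * t₂)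

/-- The eigenvalues of the output on the product of the basis states number `i.1` and `i.2`. -/
noncomputable def productEigenvalue (p₀ t₁ q₀ t₂ : ℝ) (i p : m × n) : ℝ :=
  (p₀ + if p.1 = i.1 then t₁ else 0) * (q₀ + if p.2 = i.2 then t₂ else 0)

variable {s : m × n → ℝ}

theorem rowWeight_of_ne_zero (hs : IsPartialMatching s) {p : m × n} (hp : s p ≠ 0) :
    rowWeight s p = s p ^ 2 := by
  rw [rowWeight, Finset.sum_eq_single p]
  · simp
  · intro i _ hi
    split_ifs with h
    · by_contra h0
      exact hi (hs p i hp (fun h1 => h0 (by simp [h1])) (Or.inl h)).symm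
    · rfl
  · simp

theorem colWeight_of_ne_zero (hs : IsPartialMatching s) {p : m × n} (hp : s p ≠ 0) :
    colWeight s p = s p ^ 2 := by
  rw [colWeight, Finset.sum_eq_single p]
  · simp
  · intro i _ hi
    split_ifs with h
    · by_contra h0
      exact hi (hs p i hp (fun h1 => h0 (by simp [h1])) (Or.inr h)).symm
    · rfl
  · simp

theorem rowWeight_nonneg (p : m × n) : 0 ≤ rowWeight s p :=
  Finset.sum_nonneg fun i _ => by split_ifs <;> positivity

theorem colWeight_nonneg (p : m × n) : 0 ≤ colWeight s p :=
  Finset.sum_nonneg fun i _ => by split_ifs <;> positivity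

theorem rowWeight_le_one (h1 : ∑ p, s p ^ 2 = 1) (p : m × n) : rowWeight s p ≤ 1 :=
  h1 ▸ Finset.sum_le_sum fun i _ => by split_ifs <;> nlinarith [sq_nonneg (s i)]

theorem colWeight_le_one (h1 : ∑ p, s p ^ 2 = 1) (p : m × n) : colWeight s p ≤ 1 :=
  h1 ▸ Finset.sum_le_sum fun i _ => by split_ifs <;> nlinarith [sq_nonneg (s i)]

theorem rowWeight_add_colWeight_le_one (h1 : ∑ p, s p ^ 2 = 1) {p : m × n} (hp : s p = 0) :
    rowWeight s p + colWeight s p ≤ 1 := by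
  rw [rowWeight, colWeight, ← Finset.sum_add_distrib, ← h1]
  refine Finset.sum_le_sum fun i _ => ?_
  split_ifs with h2 h3
  · have : p = i := Prod.ext h2 h3
    rw [← this, hp]
    norm_num
  all_goals nlinarith [sq_nonneg (s i)]

/-- The operator `I - ρ₁ ⊗ I - I ⊗ ρ₂ + ψψ*` is positive: it is the image of the pure state `ψ`
under a tensor square of the map `μ ↦ tr μ - μ`. -/
theorem wernerHolevo_quadraticForm_nonneg (hs : IsPartialMatching s) (h1 : ∑ p, s p ^ 2 = 1)
    (f : m × n → ℝ) :
    0 ≤ ∑ p, (1 - rowWeight s p - colWeight s p) * f p ^ 2 + (∑ p, s p * f p) ^ 2 := by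
  set g : m × n → ℝ := fun p => if s p = 0 then 0 else f p with hg
  have hsg : ∑ p, s p * f p = ∑ p, s p * g p := by
    refine Finset.sum_congr rfl fun p _ => ?_
    by_cases hp : s p = 0 <;> simp [hg, hp]
  have hle : ∑ p, (1 - 2 * s p ^ 2) * g p ^ 2 ≤
      ∑ p, (1 - rowWeight s p - colWeight s p) * f p ^ 2 := by
    refine Finset.sum_le_sum fun p _ => ?_
    by_cases hp : s p = 0
    · have := rowWeight_add_colWeight_le_one h1 hp
      simp only [hg, hp, if_true]
      nlinarith [sq_nonneg (f p)]
    · rw [rowWeight_of_ne_zero hs hp, colWeight_of_ne_zero hs hp]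
      simp only [hg, hp, if_false]
      exact le_of_eq (by ring)
  have hkey := two_mul_sum_sq_mul_sq_le s g h1
  simp only [sub_mul, one_mul, Finset.sum_sub_distrib, mul_assoc, ← Finset.mul_sum] at hle
  simp only [sub_mul, one_mul, Finset.sum_sub_distrib]
  rw [hsg]
  linarith

/-- The entropy bound, given a parabola below `-x log x` on the spectrum of the output that agrees
with it at the eigenvalues `p₀ q₀` and `(p₀ + t₁) (q₀ + t₂)` of the output on product states. -/
theorem sum_mul_sum_le_of_quadratic (hs : IsPartialMatching s) (h1 : ∑ p, s p ^ 2 = 1)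
    {p₀ t₁ q₀ t₂ β γ : ℝ} (hp₀ : 0 ≤ p₀) (hq₀ : 0 ≤ q₀) (hp : 0 ≤ p₀ + t₁) (hq : 0 ≤ q₀ + t₂)
    (hγ : 0 ≤ γ)
    (hm : 0 ≤ (t₁ * q₀ + p₀ * t₂) * (t₁ * q₀ + p₀ * t₂ + 2 * (t₁ * t₂)))
    (hz : Real.negMulLog ((p₀ + t₁) * (q₀ + t₂)) = Real.negMulLog (p₀ * q₀) +
      β * ((p₀ + t₁) * (q₀ + t₂) - p₀ * q₀) - γ * ((p₀ + t₁) * (q₀ + t₂) - p₀ * q₀) ^ 2)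
    (h : (schmidtOutput p₀ t₁ q₀ t₂ s).IsHermitian)
    (hle : ∀ k, Real.negMulLog (p₀ * q₀) + β * (h.eigenvalues k - p₀ * q₀) -
      γ * (h.eigenvalues k - p₀ * q₀) ^ 2 ≤ Real.negMulLog (h.eigenvalues k)) :
    ∑ i, s i ^ 2 * ∑ p, Real.negMulLog (productEigenvalue p₀ t₁ q₀ t₂ i p) ≤
      vonNeumannEntropy (schmidtOutput p₀ t₁ q₀ t₂ s) := by
  rw [vonNeumannEntropy_eq_sum_eigenWeight h]
  simp only [Finset.mul_sum]
  rw [Finset.sum_comm]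
  refine Finset.sum_le_sum fun p _ => ?_
  by_cases hsp : s p = 0
  · -- A basis state off the support is an eigenvector, with eigenvalue linear in `s²`.
    have hD : p₀ * q₀ + t₁ * q₀ * rowWeight s p + p₀ * t₂ * colWeight s p =
        ∑ i, s i ^ 2 * productEigenvalue p₀ t₁ q₀ t₂ i p := by
      rw [rowWeight, colWeight, ← mul_one (p₀ * q₀), ← h1, Finset.mul_sum, Finset.mul_sum,
        Finset.mul_sum, ← Finset.sum_add_distrib, ← Finset.sum_add_distrib]
      refine Finset.sum_congr rfl fun i _ => ?_
      rw [productEigenvalue]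
      split_ifs with h2 h3
      · rw [← show p = i from Prod.ext h2 h3, hsp]
        ring
      all_goals ring
    have hv : ∀ i, 0 ≤ productEigenvalue p₀ t₁ q₀ t₂ i p := by
      intro i
      rw [productEigenvalue]
      refine mul_nonneg ?_ ?_ <;> split_ifs <;> simpa
    rw [sum_eigenWeight_mul_of_row_eq h (i := p)
      (a := p₀ * q₀ + t₁ * q₀ * rowWeight s p + p₀ * t₂ * colWeight s p)
      (fun j => by rw [schmidtOutput, diagAddRankOne_apply, hsp]; split_ifs <;> simp), hD]
    have := Real.concaveOn_negMulLog.le_map_sum (t := Finset.univ)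
      (fun i _ => sq_nonneg (s i)) h1 (fun i _ => hv i)
    simpa only [smul_eq_mul] using this
  · -- On the support the quadratic minorant only involves the entries of `σ` and `σ²`.
    have hR := rowWeight_of_ne_zero hs hsp
    have hC := colWeight_of_ne_zero hs hsp
    have hfirst : ∑ k, eigenWeight h p k * h.eigenvalues k =
        p₀ * q₀ + (t₁ * q₀ + p₀ * t₂ + t₁ * t₂) * s p ^ 2 := by
      rw [sum_eigenWeight_mul_eigenvalues, schmidtOutput, diagAddRankOne_apply, if_pos rfl,
        Complex.ofReal_re, hR, hC]
      ring
    have hsecond : ∑ k, eigenWeight h p k * h.eigenvalues k ^ 2 =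
        (p₀ * q₀ + (t₁ * q₀ + p₀ * t₂) * s p ^ 2) ^ 2 +
        2 * (p₀ * q₀ + (t₁ * q₀ + p₀ * t₂) * s p ^ 2) * (t₁ * t₂) * s p ^ 2 +
        (t₁ * t₂) ^ 2 * s p ^ 2 := by
      rw [sum_eigenWeight_mul_eigenvalues_sq, schmidtOutput, diagAddRankOne_mul_self_apply _ _ _ h1,
        hR, hC]
      ring
    have hlow : ∑ k, eigenWeight h p k * (Real.negMulLog (p₀ * q₀) +
        β * (h.eigenvalues k - p₀ * q₀) - γ * (h.eigenvalues k - p₀ * q₀) ^ 2) ≤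
        ∑ k, eigenWeight h p k * Real.negMulLog (h.eigenvalues k) :=
      Finset.sum_le_sum fun k _ => mul_le_mul_of_nonneg_left (hle k) (eigenWeight_nonneg h p k)
    have hexp : ∑ k, eigenWeight h p k * (Real.negMulLog (p₀ * q₀) +
        β * (h.eigenvalues k - p₀ * q₀) - γ * (h.eigenvalues k - p₀ * q₀) ^ 2) =
        (Real.negMulLog (p₀ * q₀) - β * (p₀ * q₀) - γ * (p₀ * q₀) ^ 2) *
          ∑ k, eigenWeight h p k + (β + 2 * γ * (p₀ * q₀)) *
          ∑ k, eigenWeight h p k * h.eigenvalues k -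
          γ * ∑ k, eigenWeight h p k * h.eigenvalues k ^ 2 := by
      rw [Finset.mul_sum, Finset.mul_sum, Finset.mul_sum, ← Finset.sum_add_distrib,
        ← Finset.sum_sub_distrib]
      exact Finset.sum_congr rfl fun k _ => by ring
    rw [sum_eigenWeight_row, hfirst, hsecond] at hexp
    have hvert : ∑ i, s i ^ 2 * Real.negMulLog (productEigenvalue p₀ t₁ q₀ t₂ i p) =
        Real.negMulLog (p₀ * q₀) + s p ^ 2 * (Real.negMulLog ((p₀ + t₁) * (q₀ + t₂)) -
          Real.negMulLog (p₀ * q₀)) := by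
      have hi : ∀ i, s i ^ 2 * Real.negMulLog (productEigenvalue p₀ t₁ q₀ t₂ i p) =
          s i ^ 2 * Real.negMulLog (p₀ * q₀) + if p = i then
            s i ^ 2 * (Real.negMulLog ((p₀ + t₁) * (q₀ + t₂)) -
              Real.negMulLog (p₀ * q₀)) else 0 := by
        intro i
        by_cases hsi : s i = 0
        · simp [hsi]
        · rcases eq_or_ne p i with hpi | hpi
          · simp only [productEigenvalue, hpi, if_true]
            ring
          · rw [productEigenvalue, if_neg fun h' => hpi (hs p i hsp hsi (Or.inl h')),
              if_neg fun h' => hpi (hs p i hsp hsi (Or.inr h')), if_neg hpi]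
            simp
      rw [Finset.sum_congr rfl fun i _ => hi i, Finset.sum_add_distrib, ← Finset.sum_mul, h1]
      simp
    have hsp1 : s p ^ 2 ≤ 1 := h1 ▸ Finset.single_le_sum (f := fun p => s p ^ 2)
      (fun p' _ => sq_nonneg _) (Finset.mem_univ p)
    have hgain : 0 ≤ γ * (((t₁ * q₀ + p₀ * t₂) * (t₁ * q₀ + p₀ * t₂ + 2 * (t₁ * t₂))) *
        (s p ^ 2 * (1 - s p ^ 2))) :=
      mul_nonneg hγ (mul_nonneg hm (mul_nonneg (sq_nonneg _) (by linarith)))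
    rw [hvert, hz]
    refine le_trans (le_trans (sub_nonneg.mp (hgain.trans (le_of_eq ?_))) hexp.ge) hlow
    ring

/-- Nonpositive parameters: all eigenvalues of the output are at least the smallest one that
occurs for product states. -/
theorem le_eigenvalues_schmidtOutput (hs : IsPartialMatching s) (h1 : ∑ p, s p ^ 2 = 1)
    {p₀ t₁ q₀ t₂ : ℝ} (hp : 0 ≤ p₀ + t₁) (hq : 0 ≤ q₀ + t₂) (ht₁ : t₁ ≤ 0) (ht₂ : t₂ ≤ 0)
    (h : (schmidtOutput p₀ t₁ q₀ t₂ s).IsHermitian) (k : m × n) :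
    (p₀ + t₁) * (q₀ + t₂) ≤ h.eigenvalues k := by
  refine le_eigenvalues_diagAddRankOne (fun f => ?_) h k
  have hW := mul_nonneg (mul_nonneg_of_nonpos_of_nonpos ht₁ ht₂)
    (wernerHolevo_quadraticForm_nonneg hs h1 f)
  have hle : ∑ p, ((p₀ + t₁) * (q₀ + t₂) * f p ^ 2 +
      t₁ * t₂ * ((1 - rowWeight s p - colWeight s p) * f p ^ 2)) ≤
      ∑ p, (p₀ * q₀ + t₁ * q₀ * rowWeight s p + p₀ * t₂ * colWeight s p) * f p ^ 2 := by
    refine Finset.sum_le_sum fun p _ => ?_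
    have hA : 0 ≤ -t₁ * (q₀ + t₂) * (1 - rowWeight s p) :=
      mul_nonneg (mul_nonneg (by linarith) hq) (by linarith [rowWeight_le_one h1 p])
    have hB : 0 ≤ -t₂ * (p₀ + t₁) * (1 - colWeight s p) :=
      mul_nonneg (mul_nonneg (by linarith) hp) (by linarith [colWeight_le_one h1 p])
    have hAB := mul_nonneg (add_nonneg hA hB) (sq_nonneg (f p))
    refine sub_nonneg.mp (hAB.trans (le_of_eq ?_))
    ring
  rw [Finset.sum_add_distrib, ← Finset.mul_sum, ← Finset.mul_sum] at hle
  rw [mul_add] at hW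
  linarith

/-- Nonnegative parameters: the eigenvalues of the output lie between the two extreme ones that
occur for product states. -/
theorem eigenvalues_schmidtOutput_mem_Icc (h1 : ∑ p, s p ^ 2 = 1)
    {p₀ t₁ q₀ t₂ : ℝ} (hp₀ : 0 ≤ p₀) (hq₀ : 0 ≤ q₀) (ht₁ : 0 ≤ t₁) (ht₂ : 0 ≤ t₂)
    (h : (schmidtOutput p₀ t₁ q₀ t₂ s).IsHermitian) (k : m × n) :
    h.eigenvalues k ∈ Set.Icc (p₀ * q₀) ((p₀ + t₁) * (q₀ + t₂)) := by
  have htt : 0 ≤ t₁ * t₂ := mul_nonneg ht₁ ht₂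
  have hA : 0 ≤ t₁ * q₀ := mul_nonneg ht₁ hq₀
  have hB : 0 ≤ p₀ * t₂ := mul_nonneg hp₀ ht₂
  refine ⟨le_eigenvalues_diagAddRankOne (fun f => ?_) h k,
    eigenvalues_diagAddRankOne_le (fun f => ?_) h k⟩
  · have hle : p₀ * q₀ * ∑ p, f p ^ 2 ≤
        ∑ p, (p₀ * q₀ + t₁ * q₀ * rowWeight s p + p₀ * t₂ * colWeight s p) * f p ^ 2 := by
      rw [Finset.mul_sum]
      refine Finset.sum_le_sum fun p _ => mul_le_mul_of_nonneg_right ?_ (sq_nonneg _)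
      linarith [mul_nonneg hA (rowWeight_nonneg (s := s) p),
        mul_nonneg hB (colWeight_nonneg (s := s) p)]
    linarith [mul_nonneg htt (sq_nonneg (∑ p, s p * f p))]
  · have hle : ∑ p, (p₀ * q₀ + t₁ * q₀ * rowWeight s p + p₀ * t₂ * colWeight s p) * f p ^ 2 ≤
        (p₀ * q₀ + t₁ * q₀ + p₀ * t₂) * ∑ p, f p ^ 2 := by
      rw [Finset.mul_sum]
      refine Finset.sum_le_sum fun p _ => mul_le_mul_of_nonneg_right ?_ (sq_nonneg _)
      linarith [mul_nonneg hA (sub_nonneg.mpr (rowWeight_le_one h1 p)),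
        mul_nonneg hB (sub_nonneg.mpr (colWeight_le_one h1 p))]
    have hcs := Finset.sum_mul_sq_le_sq_mul_sq Finset.univ s f
    rw [h1, one_mul] at hcs
    linarith [mul_le_mul_of_nonneg_left hcs htt]

/-- The entropy of the output on a pure state is at least the average, over its Schmidt
decomposition, of the entropies of the outputs on product states. -/
theorem sum_mul_sum_le_vonNeumannEntropy_schmidtOutput (hs : IsPartialMatching s)
    (h1 : ∑ p, s p ^ 2 = 1) {p₀ t₁ q₀ t₂ : ℝ} (hp₀ : 0 < p₀) (hq₀ : 0 < q₀)
    (hp : 0 ≤ p₀ + t₁) (hq : 0 ≤ q₀ + t₂) (ht : t₁ ≤ 0 ∧ t₂ ≤ 0 ∨ 0 ≤ t₁ ∧ 0 ≤ t₂) :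
    ∑ i, s i ^ 2 * ∑ p, Real.negMulLog (productEigenvalue p₀ t₁ q₀ t₂ i p) ≤
      vonNeumannEntropy (schmidtOutput p₀ t₁ q₀ t₂ s) := by
  have h : (schmidtOutput p₀ t₁ q₀ t₂ s).IsHermitian := isHermitian_diagAddRankOne _ _ _
  have hzc : (p₀ + t₁) * (q₀ + t₂) - p₀ * q₀ = t₁ * (q₀ + t₂) + p₀ * t₂ := by ring
  by_cases hpos : 0 ≤ t₁ ∧ 0 ≤ t₂
  · obtain ⟨ht₁, ht₂⟩ := hpos
    have hcz : p₀ * q₀ ≤ (p₀ + t₁) * (q₀ + t₂) := by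
      rw [← sub_nonneg, hzc]
      positivity
    obtain ⟨β, hβ, hle⟩ := exists_chord_minorant (mul_pos hp₀ hq₀).le hcz
    refine sum_mul_sum_le_of_quadratic hs h1 hp₀.le hq₀.le hp hq (le_refl 0) (by positivity)
      (β := β) (by rw [hβ]; ring) h fun k => ?_
    have hk := eigenvalues_schmidtOutput_mem_Icc h1 hp₀.le hq₀.le ht₁ ht₂ h k
    linarith [hle _ hk.1 hk.2]
  · obtain ⟨ht₁, ht₂⟩ := ht.resolve_right hpos
    have hA : t₁ * (q₀ + t₂) ≤ 0 := mul_nonpos_of_nonpos_of_nonneg ht₁ hq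
    have hB : p₀ * t₂ ≤ 0 := mul_nonpos_of_nonneg_of_nonpos hp₀.le ht₂
    have hlt : (p₀ + t₁) * (q₀ + t₂) < p₀ * q₀ := by
      rw [← sub_neg, hzc]
      rcases ht₂.eq_or_lt with h2 | h2
      · subst h2
        have : t₁ < 0 := lt_of_not_ge fun h3 => hpos ⟨h3, le_rfl⟩
        nlinarith
      · nlinarith
    obtain ⟨β, γ, hγ, hz, hle⟩ := exists_quadratic_minorant (mul_nonneg hp hq) hlt
    refine sum_mul_sum_le_of_quadratic hs h1 hp₀.le hq₀.le hp hq hγ ?_ hz h fun k =>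
      hle _ (le_eigenvalues_schmidtOutput hs h1 hp hq ht₁ ht₂ h k)
    have hC : (p₀ + t₁) * t₂ ≤ 0 := mul_nonpos_of_nonneg_of_nonpos hp ht₂
    have hD : t₁ * q₀ ≤ 0 := mul_nonpos_of_nonpos_of_nonneg ht₁ hq₀.le
    refine mul_nonneg_of_nonpos_of_nonpos (by linarith) ?_
    linarith

end Schmidt

/-! ### The output on pure states -/

section Output

theorem channel_apply (d : ℕ) (t : ℝ) (μ : Matrix (Fin d) (Fin d) ℂ) :
    channel d t μ = (t : ℂ) • μ.transpose +
      ((((1 - t) / d : ℝ) : ℂ) * μ.trace) • (1 : Matrix (Fin d) (Fin d) ℂ) := by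
  show (t : ℂ) • μ.transpose + (((1 - t : ℝ) : ℂ) * μ.trace / (d : ℂ)) • _ = _
  congr 2
  push_cast
  ring

theorem channel_single_apply (d : ℕ) (t : ℝ) (i j a c : Fin d) :
    channel d t (Matrix.single i j 1) a c = (if i = c then if j = a then (t : ℂ) else 0 else 0) +
      if i = j then if a = c then (((1 - t) / d : ℝ) : ℂ) else 0 else 0 := by
  rw [channel_apply, Matrix.add_apply, Matrix.smul_apply, Matrix.smul_apply,
    Matrix.transpose_apply, Matrix.single_apply, Matrix.one_apply]
  congr 1
  · split_ifs <;> simp_all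
  · rcases eq_or_ne i j with h | h
    · subst h
      rw [Matrix.trace_single_eq_same]
      simp
    · rw [Matrix.trace_single_eq_of_ne _ _ _ h, if_neg h]
      simp

variable {m n : Type*} [Fintype m] [DecidableEq m] [Fintype n] [DecidableEq n]

/-- The matrix `t₁ t₂ ψψ* + t₁ q₀ ρ₁ ⊗ I + p₀ t₂ I ⊗ ρ₂ + p₀ q₀ I`, where `ρ₁` and `ρ₂` are the
partial traces of `ψψ*` and `ψ` is given by its matrix `B` of coordinates. -/
noncomputable def pureOutput (p₀ t₁ q₀ t₂ : ℝ) (B : Matrix m n ℂ) : Matrix (m × n) (m × n) ℂ :=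
  ((t₁ * t₂ : ℝ) : ℂ) • Matrix.vecMulVec (fun p => B p.1 p.2) (fun p => star (B p.1 p.2)) +
    ((t₁ * q₀ : ℝ) : ℂ) • ((B * B.conjTranspose) ⊗ₖ (1 : Matrix n n ℂ)) +
    ((p₀ * t₂ : ℝ) : ℂ) •
      ((1 : Matrix m m ℂ) ⊗ₖ (B.transpose * B.transpose.conjTranspose)) +
    ((p₀ * q₀ : ℝ) : ℂ) • 1

theorem tensor_channel_vecMulVec {d₁ d₂ : ℕ} (t₁ t₂ : ℝ) (B : Matrix (Fin d₁) (Fin d₂) ℂ)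
    (hB : (B * B.conjTranspose).trace = 1) :
    tensor (channel d₁ t₁) (channel d₂ t₂)
        (Matrix.vecMulVec (fun p => B p.1 p.2) (fun p => star (B p.1 p.2))).transpose =
      pureOutput ((1 - t₁) / d₁) t₁ ((1 - t₂) / d₂) t₂ B := by
  have hB' : ∑ i, ∑ k, B i k * star (B i k) = 1 := by
    rw [← hB]
    simp [Matrix.trace, Matrix.mul_apply]
  ext ⟨a, b⟩ ⟨a', b'⟩
  simp only [tensor, LinearMap.coe_mk, AddHom.coe_mk, Matrix.sum_apply, Matrix.smul_apply,
    Matrix.kroneckerMap_apply, smul_eq_mul, channel_single_apply, pureOutput, Matrix.add_apply,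
    Matrix.vecMulVec_apply, Matrix.transpose_apply, Matrix.mul_apply, Matrix.conjTranspose_apply,
    Matrix.one_apply, Prod.mk.injEq]
  generalize (((1 - t₁) / d₁ : ℝ)) = p₀
  generalize (((1 - t₂) / d₂ : ℝ)) = q₀
  simp only [mul_add, add_mul, Finset.sum_add_distrib, ite_mul, mul_ite, mul_zero, zero_mul,
    Finset.sum_ite_eq, Finset.sum_ite_eq', Finset.mem_univ, if_true, Finset.sum_ite_irrel,
    Finset.sum_const_zero]
  by_cases h : a = a' <;> by_cases h' : b = b' <;>
    simp only [h, h', and_self, and_true, and_false, if_true, if_false,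
      ← Finset.sum_mul, hB'] <;> push_cast <;> ring

theorem schmidtOutput_eq {s : m × n → ℝ} (hs : IsPartialMatching s) (p₀ t₁ q₀ t₂ : ℝ) :
    schmidtOutput p₀ t₁ q₀ t₂ s =
      pureOutput p₀ t₁ q₀ t₂ (Matrix.of fun j k => (s (j, k) : ℂ)) := by
  have hrow : ∀ j j' k, ∑ k', (s (j, k') : ℂ) * star (s (j', k') : ℂ) =
      if j = j' then ((rowWeight s (j, k) : ℝ) : ℂ) else 0 := by
    intro j j' k
    split_ifs with h
    · subst h
      rw [rowWeight, Fintype.sum_prod_type, Finset.sum_comm]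
      simp [pow_two]
    · refine Finset.sum_eq_zero fun k' _ => ?_
      by_contra h0
      rw [mul_eq_zero, not_or] at h0
      exact h (congrArg Prod.fst (hs (j, k') (j', k') (by simpa using h0.1)
        (by simpa using h0.2) (Or.inr rfl)))
  have hcol : ∀ k k' j, ∑ j', (s (j', k) : ℂ) * star (s (j', k') : ℂ) =
      if k = k' then ((colWeight s (j, k) : ℝ) : ℂ) else 0 := by
    intro k k' j
    split_ifs with h
    · subst h
      rw [colWeight, Fintype.sum_prod_type]
      simp [pow_two]
    · refine Finset.sum_eq_zero fun j' _ => ?_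
      by_contra h0
      rw [mul_eq_zero, not_or] at h0
      exact h (congrArg Prod.snd (hs (j', k) (j', k') (by simpa using h0.1)
        (by simpa using h0.2) (Or.inl rfl)))
  ext ⟨j, k⟩ ⟨j', k'⟩
  simp only [schmidtOutput, diagAddRankOne_apply, pureOutput, Matrix.add_apply, Matrix.smul_apply,
    Matrix.kroneckerMap_apply, Matrix.vecMulVec_apply, Matrix.mul_apply, Matrix.of_apply,
    Matrix.conjTranspose_apply, Matrix.transpose_apply, Matrix.one_apply, smul_eq_mul,
    Prod.mk.injEq, hrow j j' k, hcol k k' j]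
  by_cases h : j = j' <;> by_cases h' : k = k' <;>
    simp only [h, h', and_self, and_true, and_false, if_true, if_false, Complex.star_def,
      Complex.conj_ofReal] <;> push_cast <;> ring

theorem pureOutput_mul (p₀ t₁ q₀ t₂ : ℝ) {U : Matrix m m ℂ} {V : Matrix n n ℂ}
    (hU : U ∈ Matrix.unitaryGroup m ℂ) (hV : V ∈ Matrix.unitaryGroup n ℂ) (B : Matrix m n ℂ) :
    pureOutput p₀ t₁ q₀ t₂ (U * B * V.transpose) =
      (U ⊗ₖ V) * pureOutput p₀ t₁ q₀ t₂ B * star (U ⊗ₖ V) := by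
  have hU' : U * U.conjTranspose = 1 := Matrix.mem_unitaryGroup_iff.mp hU
  have hV' : V * V.conjTranspose = 1 := Matrix.mem_unitaryGroup_iff.mp hV
  have hvec : (fun p : m × n => (U * B * V.transpose) p.1 p.2) =
      Matrix.mulVec (U ⊗ₖ V) fun p => B p.1 p.2 := by
    ext p
    simp only [Matrix.mul_apply, Matrix.mulVec, dotProduct, Matrix.kroneckerMap_apply,
      Matrix.transpose_apply, Fintype.sum_prod_type, Finset.sum_mul]
    rw [Finset.sum_comm]
    exact Finset.sum_congr rfl fun j _ => Finset.sum_congr rfl fun k _ => by ring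
  have h1 : Matrix.vecMulVec (fun p : m × n => (U * B * V.transpose) p.1 p.2)
      (fun p => star ((U * B * V.transpose) p.1 p.2)) =
      (U ⊗ₖ V) * Matrix.vecMulVec (fun p => B p.1 p.2) (fun p => star (B p.1 p.2)) *
        (U ⊗ₖ V).conjTranspose := by
    have hst : (fun p : m × n => star ((U * B * V.transpose) p.1 p.2)) =
        star fun p : m × n => (U * B * V.transpose) p.1 p.2 := rfl
    rw [hst, hvec, Matrix.mul_vecMulVec, Matrix.vecMulVec_mul, Matrix.star_mulVec]
    rfl
  have h2 : (U * B * V.transpose) * (U * B * V.transpose).conjTranspose =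
      U * (B * B.conjTranspose) * U.conjTranspose := by
    have h : V.transpose * V.transpose.conjTranspose = 1 :=
      Matrix.mem_unitaryGroup_iff.mp (Matrix.transpose_mem_unitaryGroup_iff.mpr hV)
    rw [Matrix.conjTranspose_mul, Matrix.conjTranspose_mul, Matrix.mul_assoc (U * B),
      ← Matrix.mul_assoc V.transpose, h, Matrix.one_mul]
    simp only [Matrix.mul_assoc]
  have h3 : (U * B * V.transpose).transpose * (U * B * V.transpose).transpose.conjTranspose =
      V * (B.transpose * B.transpose.conjTranspose) * V.conjTranspose := by
    have h : U.transpose * U.transpose.conjTranspose = 1 :=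
      Matrix.mem_unitaryGroup_iff.mp (Matrix.transpose_mem_unitaryGroup_iff.mpr hU)
    rw [Matrix.transpose_mul, Matrix.transpose_mul, Matrix.transpose_transpose,
      Matrix.conjTranspose_mul, Matrix.conjTranspose_mul, Matrix.mul_assoc V,
      Matrix.mul_assoc B.transpose, ← Matrix.mul_assoc U.transpose, ← Matrix.mul_assoc U.transpose,
      h, Matrix.one_mul]
    simp only [Matrix.mul_assoc]
  rw [pureOutput, pureOutput, h1, h2, h3, Matrix.star_eq_conjTranspose]
  simp only [Matrix.mul_add, Matrix.add_mul, Matrix.mul_smul, Matrix.smul_mul,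
    Matrix.conjTranspose_kronecker, ← Matrix.mul_kronecker_mul, Matrix.mul_one, hU', hV',
    Matrix.one_kronecker_one]

end Output

/-! ### Additivity -/

section Additivity

/-- The conditions on the coefficients of `μ ↦ t μᵀ + p₀ (tr μ) I` on `d × d` matrices under which
the output on a pure state, with eigenvalues `p₀` and `p₀ + t`, is a density matrix; in addition
`p₀` is nonzero. -/
structure IsAdmissible (d : ℕ) (p₀ t : ℝ) : Prop where
  pos : 0 < p₀
  add_nonneg : 0 ≤ p₀ + t
  mul_add_eq : d * p₀ + t = 1

theorem isAdmissible {d : ℕ} {t : ℝ} (hd : 2 ≤ d) (h1 : -(1 / ((d : ℝ) - 1)) ≤ t)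
    (h2 : t ≤ 1 / ((d : ℝ) + 1)) : IsAdmissible d ((1 - t) / d) t := by
  have hd' : (2 : ℝ) ≤ d := by exact_mod_cast hd
  have h3 : 1 / ((d : ℝ) + 1) < 1 := by
    rw [div_lt_one (by linarith)]
    linarith
  refine ⟨div_pos (by linarith) (by linarith), ?_, by field_simp; ring⟩
  have h4 : -1 ≤ t * (d - 1) := by
    rw [← neg_div, div_le_iff₀ (by linarith)] at h1
    exact h1
  have h5 : (1 - t) / d + t = (1 + t * (d - 1)) / d := by
    field_simp
    ring
  rw [h5]
  exact div_nonneg (by linarith) (by linarith)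

/-- The entropy of the output of the transpose depolarizing channel on a pure state, in terms of
the coefficient `p₀` of the unit matrix: the output has the eigenvalue `p₀ + t` once and the
eigenvalue `p₀` with multiplicity `d - 1`. -/
noncomputable def pureEntropy (d : ℕ) (p₀ t : ℝ) : ℝ :=
  (d - 1) * Real.negMulLog p₀ + Real.negMulLog (p₀ + t)

theorem sum_negMulLog_eq_pureEntropy {d : ℕ} (p₀ t : ℝ) (i : Fin d) :
    ∑ j, Real.negMulLog (p₀ + if j = i then t else 0) = pureEntropy d p₀ t := by
  have h : ∀ j, Real.negMulLog (p₀ + if j = i then t else 0) = Real.negMulLog p₀ +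
      if j = i then Real.negMulLog (p₀ + t) - Real.negMulLog p₀ else 0 := by
    intro j
    split_ifs <;> simp
  rw [Finset.sum_congr rfl fun j _ => h j, Finset.sum_add_distrib, pureEntropy]
  simp
  ring

theorem IsAdmissible.sum_eq_one {d : ℕ} {p₀ t : ℝ} (h : IsAdmissible d p₀ t) (i : Fin d) :
    ∑ j : Fin d, (p₀ + if j = i then t else 0) = 1 := by
  rw [← h.mul_add_eq, Finset.sum_add_distrib]
  simp

theorem IsAdmissible.ite_nonneg {d : ℕ} {p₀ t : ℝ} (h : IsAdmissible d p₀ t) (i j : Fin d) :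
    0 ≤ p₀ + if j = i then t else 0 := by
  split_ifs
  · exact h.add_nonneg
  · simpa using h.pos.le

theorem sum_negMulLog_mul {m n : Type*} [Fintype m] [Fintype n] (x : m → ℝ) (y : n → ℝ)
    (hx : ∑ j, x j = 1) (hy : ∑ k, y k = 1) :
    ∑ p : m × n, Real.negMulLog (x p.1 * y p.2) =
      ∑ j, Real.negMulLog (x j) + ∑ k, Real.negMulLog (y k) := by
  simp only [Fintype.sum_prod_type, Real.negMulLog_mul, Finset.sum_add_distrib, ← Finset.sum_mul,
    ← Finset.mul_sum, hx, hy, one_mul]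

theorem sum_negMulLog_productEigenvalue {d₁ d₂ : ℕ} {p₀ t₁ q₀ t₂ : ℝ}
    (h₁ : IsAdmissible d₁ p₀ t₁) (h₂ : IsAdmissible d₂ q₀ t₂) (i : Fin d₁ × Fin d₂) :
    ∑ p, Real.negMulLog (productEigenvalue p₀ t₁ q₀ t₂ i p) =
      pureEntropy d₁ p₀ t₁ + pureEntropy d₂ q₀ t₂ := by
  simp only [productEigenvalue]
  rw [sum_negMulLog_mul (fun j => p₀ + if j = i.1 then t₁ else 0)
    (fun k => q₀ + if k = i.2 then t₂ else 0) (h₁.sum_eq_one i.1) (h₂.sum_eq_one i.2),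
    sum_negMulLog_eq_pureEntropy, sum_negMulLog_eq_pureEntropy]

theorem posSemidef_schmidtOutput {m n : Type*} [Fintype m] [DecidableEq m] [Fintype n]
    [DecidableEq n] {s : m × n → ℝ} (hs : IsPartialMatching s) (h1 : ∑ p, s p ^ 2 = 1)
    {p₀ t₁ q₀ t₂ : ℝ} (hp₀ : 0 ≤ p₀) (hq₀ : 0 ≤ q₀) (hp : 0 ≤ p₀ + t₁) (hq : 0 ≤ q₀ + t₂)
    (ht : t₁ ≤ 0 ∧ t₂ ≤ 0 ∨ 0 ≤ t₁ ∧ 0 ≤ t₂) : (schmidtOutput p₀ t₁ q₀ t₂ s).PosSemidef := by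
  have h : (schmidtOutput p₀ t₁ q₀ t₂ s).IsHermitian := isHermitian_diagAddRankOne _ _ _
  rw [h.posSemidef_iff_eigenvalues_nonneg]
  intro k
  rcases ht with ht | ht
  · exact (mul_nonneg hp hq).trans (le_eigenvalues_schmidtOutput hs h1 hp hq ht.1 ht.2 h k)
  · exact (mul_nonneg hp₀ hq₀).trans
      (eigenvalues_schmidtOutput_mem_Icc h1 hp₀ hq₀ ht.1 ht.2 h k).1

/-- The entropy bound for pure input states. -/
theorem pureOutput_posSemidef_and_le_entropy {d₁ d₂ : ℕ} {p₀ t₁ q₀ t₂ : ℝ}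
    (h₁ : IsAdmissible d₁ p₀ t₁) (h₂ : IsAdmissible d₂ q₀ t₂)
    (ht : t₁ ≤ 0 ∧ t₂ ≤ 0 ∨ 0 ≤ t₁ ∧ 0 ≤ t₂) {B : Matrix (Fin d₁) (Fin d₂) ℂ}
    (hB : (B * B.conjTranspose).trace = 1) :
    (pureOutput p₀ t₁ q₀ t₂ B).PosSemidef ∧ pureEntropy d₁ p₀ t₁ + pureEntropy d₂ q₀ t₂ ≤
      vonNeumannEntropy (pureOutput p₀ t₁ q₀ t₂ B) := by
  obtain ⟨U, hU, V, hV, s, hs, rfl⟩ := exists_singularValueDecomposition B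
  have hs1 : ∑ p, s p ^ 2 = 1 := by
    have hV' : V.transpose * V.transpose.conjTranspose = 1 :=
      Matrix.mem_unitaryGroup_iff.mp (Matrix.transpose_mem_unitaryGroup_iff.mpr hV)
    have hU' : U.conjTranspose * U = 1 := Matrix.mem_unitaryGroup_iff'.mp hU
    rw [Matrix.conjTranspose_mul, Matrix.mul_assoc, ← Matrix.mul_assoc V.transpose, hV',
      Matrix.one_mul, Matrix.trace_mul_comm, Matrix.conjTranspose_mul, Matrix.mul_assoc,
      ← Matrix.mul_assoc U.conjTranspose, hU', Matrix.one_mul] at hB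
    simp only [Matrix.trace, Matrix.diag_apply, Matrix.mul_apply, Matrix.conjTranspose_apply,
      Matrix.of_apply, Complex.star_def, Complex.conj_ofReal] at hB
    rw [Fintype.sum_prod_type, Finset.sum_comm]
    simp only [pow_two]
    exact_mod_cast hB
  rw [pureOutput_mul _ _ _ _ hU hV, ← schmidtOutput_eq hs]
  refine ⟨(posSemidef_schmidtOutput hs hs1 h₁.pos.le h₂.pos.le h₁.add_nonneg h₂.add_nonneg
    ht).mul_mul_conjTranspose_same _, ?_⟩
  have hH : (schmidtOutput p₀ t₁ q₀ t₂ s).IsHermitian := isHermitian_diagAddRankOne _ _ _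
  rw [vonNeumannEntropy_conj (Matrix.kronecker_mem_unitary hU hV) hH]
  refine le_trans (le_of_eq ?_) (sum_mul_sum_le_vonNeumannEntropy_schmidtOutput hs hs1 h₁.pos
    h₂.pos h₁.add_nonneg h₂.add_nonneg ht)
  simp only [sum_negMulLog_productEigenvalue h₁ h₂]
  rw [← Finset.sum_mul, hs1, one_mul]

theorem IsDensityMatrix.sum_eigenvalues {n : Type*} [Fintype n] [DecidableEq n]
    {ρ : Matrix n n ℂ} (hρ : IsDensityMatrix ρ) : ∑ k, hρ.1.1.eigenvalues k = 1 := by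
  have h := hρ.1.1.trace_eq_sum_eigenvalues.symm.trans hρ.2
  apply Complex.ofReal_injective
  rw [Complex.ofReal_sum, Complex.ofReal_one]
  exact h

/-- Spectral decomposition of a density matrix into pure states. -/
theorem IsDensityMatrix.exists_eq_sum {n : Type*} [Fintype n] [DecidableEq n]
    {ρ : Matrix n n ℂ} (hρ : IsDensityMatrix ρ) :
    ∃ (μ : n → ℝ) (v : n → n → ℂ), (∀ k, 0 ≤ μ k) ∧ ∑ k, μ k = 1 ∧
      (∀ k, ∑ i, v k i * star (v k i) = 1) ∧
      ρ = ∑ k, (μ k : ℂ) • Matrix.vecMulVec (v k) (star (v k)) := by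
  have hE := hρ.1.1.eigenvectorUnitary.2
  refine ⟨hρ.1.1.eigenvalues, fun k i => (hρ.1.1.eigenvectorUnitary : Matrix n n ℂ) i k,
    hρ.1.eigenvalues_nonneg, hρ.sum_eigenvalues, fun k => ?_, ?_⟩
  · have h := sum_normSq_col hE k
    simp only [Complex.star_def, Complex.mul_conj]
    exact_mod_cast h
  · ext i j
    conv_lhs => rw [eq_eigenvectorUnitary_mul_diagonal_mul hρ.1.1]
    simp only [Matrix.mul_apply (M := _ * _), Matrix.mul_diagonal, Matrix.sum_apply,
      Matrix.smul_apply, Matrix.vecMulVec_apply, Matrix.star_apply, Pi.star_apply, smul_eq_mul]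
    exact Finset.sum_congr rfl fun k _ => by ring

theorem IsDensityMatrix.transpose {n : Type*} [Fintype n] {ρ : Matrix n n ℂ}
    (hρ : IsDensityMatrix ρ) : IsDensityMatrix ρ.transpose :=
  ⟨hρ.1.transpose, by rw [Matrix.trace_transpose, hρ.2]⟩

theorem isDensityMatrix_single {n : Type*} [Fintype n] [DecidableEq n] (i : n) :
    IsDensityMatrix (Matrix.single i i (1 : ℂ)) := by
  refine ⟨?_, Matrix.trace_single_eq_same _ _⟩
  rw [← Matrix.diagonal_single]
  refine Matrix.PosSemidef.diagonal fun j => ?_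
  rcases eq_or_ne j i with h | h
  · subst h
    simp
  · simp [h]

theorem channel_single_self (d : ℕ) (t : ℝ) (i : Fin d) :
    channel d t (Matrix.single i i 1) =
      Matrix.diagonal fun j => (((1 - t) / d + if j = i then t else 0 : ℝ) : ℂ) := by
  ext a c
  rw [channel_single_apply, Matrix.diagonal_apply]
  rcases eq_or_ne a c with h | h
  · subst h
    rw [if_pos rfl, if_pos rfl]
    rcases eq_or_ne a i with h' | h'
    · subst h'
      simp [add_comm]
    · simp [h', h'.symm]
  · rw [if_neg h, if_neg h]
    by_cases h1 : i = c
    · simp [h1, h.symm]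
    · simp [h1]

theorem isLeast_outputEntropies_channel {d : ℕ} {t : ℝ} (hd : 0 < d)
    (h : IsAdmissible d ((1 - t) / d) t) :
    IsLeast (outputEntropies (channel d t)) (pureEntropy d ((1 - t) / d) t) := by
  refine ⟨⟨Matrix.single ⟨0, hd⟩ ⟨0, hd⟩ 1, isDensityMatrix_single _, ?_⟩, ?_⟩
  · rw [channel_single_self, vonNeumannEntropy_diagonal, sum_negMulLog_eq_pureEntropy]
  · rintro _ ⟨ρ, hρ, rfl⟩
    have hσ := hρ.transpose
    set E : Matrix (Fin d) (Fin d) ℂ := (hσ.1.1.eigenvectorUnitary : Matrix (Fin d) (Fin d) ℂ) with hE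
    have hEu : E ∈ Matrix.unitaryGroup (Fin d) ℂ := hσ.1.1.eigenvectorUnitary.2
    set μ := hσ.1.1.eigenvalues with hμ
    have hμ1 : ∑ k, μ k = 1 := hσ.sum_eigenvalues
    have hout : channel d t ρ =
        E * Matrix.diagonal (fun k => (((1 - t) / d + t * μ k : ℝ) : ℂ)) * star E := by
      have h1 : (Matrix.diagonal fun k => (((1 - t) / d + t * μ k : ℝ) : ℂ)) =
          (((1 - t) / d : ℝ) : ℂ) • (1 : Matrix (Fin d) (Fin d) ℂ) +
            (t : ℂ) • Matrix.diagonal fun k => (μ k : ℂ) := by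
        rw [← Matrix.diagonal_one, ← Matrix.diagonal_smul, ← Matrix.diagonal_smul,
          Matrix.diagonal_add]
        congr 1
        ext k
        simp
      rw [h1, Matrix.mul_add, Matrix.add_mul, Matrix.mul_smul, Matrix.smul_mul, Matrix.mul_smul,
        Matrix.smul_mul, Matrix.mul_one, Matrix.mem_unitaryGroup_iff.mp hEu,
        ← eq_eigenvectorUnitary_mul_diagonal_mul hσ.1.1, channel_apply, hρ.2, mul_one, add_comm]
    rw [hout, vonNeumannEntropy_conj hEu (Matrix.isHermitian_diagonal_of_self_adjoint _ (by
      ext i; simp)), vonNeumannEntropy_diagonal]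
    -- Each eigenvalue is an average of its values on the basis states.
    calc pureEntropy d ((1 - t) / d) t
        = ∑ i, μ i * ∑ k, Real.negMulLog ((1 - t) / d + if k = i then t else 0) := by
          simp only [sum_negMulLog_eq_pureEntropy]
          rw [← Finset.sum_mul, hμ1, one_mul]
      _ = ∑ k, ∑ i, μ i * Real.negMulLog ((1 - t) / d + if k = i then t else 0) := by
          simp only [Finset.mul_sum]
          exact Finset.sum_comm
      _ ≤ ∑ k, Real.negMulLog ((1 - t) / d + t * μ k) := by
          refine Finset.sum_le_sum fun k _ => ?_
          have hk : (1 - t) / d + t * μ k = ∑ i, μ i * ((1 - t) / d + if k = i then t else 0) := by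
            simp only [mul_add, Finset.sum_add_distrib, ← Finset.sum_mul, hμ1]
            simp [mul_comm]
          have := Real.concaveOn_negMulLog.le_map_sum (t := Finset.univ)
            (fun i _ => hσ.1.eigenvalues_nonneg i) hμ1 (fun i _ => h.ite_nonneg i k)
          rw [hk]
          simpa only [smul_eq_mul] using this

theorem isLeast_outputEntropies_tensor {d₁ d₂ : ℕ} {t₁ t₂ : ℝ} (hd₁ : 0 < d₁) (hd₂ : 0 < d₂)
    (h₁ : IsAdmissible d₁ ((1 - t₁) / d₁) t₁) (h₂ : IsAdmissible d₂ ((1 - t₂) / d₂) t₂)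
    (ht : t₁ ≤ 0 ∧ t₂ ≤ 0 ∨ 0 ≤ t₁ ∧ 0 ≤ t₂) :
    IsLeast (outputEntropies (tensor (channel d₁ t₁) (channel d₂ t₂)))
      (pureEntropy d₁ ((1 - t₁) / d₁) t₁ + pureEntropy d₂ ((1 - t₂) / d₂) t₂) := by
  let i : Fin d₁ × Fin d₂ := (⟨0, hd₁⟩, ⟨0, hd₂⟩)
  refine ⟨⟨Matrix.single i i 1, isDensityMatrix_single i, ?_⟩, ?_⟩
  · have hk : Matrix.single i i (1 : ℂ) =
        Matrix.single i.1 i.1 1 ⊗ₖ Matrix.single i.2 i.2 1 := by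
      rw [Matrix.single_kronecker_single, mul_one]
    rw [hk, tensor_kronecker, channel_single_self, channel_single_self,
      Matrix.diagonal_kronecker_diagonal]
    simp only [← Complex.ofReal_mul]
    rw [vonNeumannEntropy_diagonal]
    exact (sum_negMulLog_productEigenvalue h₁ h₂ i).symm
  · rintro _ ⟨ρ, hρ, rfl⟩
    obtain ⟨μ, v, hμ, hμ1, hv, hsum⟩ := hρ.transpose.exists_eq_sum
    let B : Fin d₁ × Fin d₂ → Matrix (Fin d₁) (Fin d₂) ℂ := fun k => Matrix.of fun i j => v k (i, j)
    have hB : ∀ k, (B k * (B k).conjTranspose).trace = 1 := by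
      intro k
      rw [← hv k, Fintype.sum_prod_type]
      simp [B, Matrix.trace, Matrix.mul_apply]
    have hout : tensor (channel d₁ t₁) (channel d₂ t₂) ρ =
        ∑ k, (μ k : ℂ) • pureOutput ((1 - t₁) / d₁) t₁ ((1 - t₂) / d₂) t₂ (B k) := by
      rw [← ρ.transpose_transpose, hsum, Matrix.transpose_sum, map_sum]
      refine Finset.sum_congr rfl fun k _ => ?_
      rw [Matrix.transpose_smul, map_smul, ← tensor_channel_vecMulVec t₁ t₂ (B k) (hB k)]
      rfl
    have hpure := fun k => pureOutput_posSemidef_and_le_entropy h₁ h₂ ht (hB k)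
    rw [hout]
    refine le_trans ?_ (sum_mul_vonNeumannEntropy_le μ hμ hμ1 _ fun k => (hpure k).1)
    refine le_trans (le_of_eq ?_) (Finset.sum_le_sum fun k _ =>
      mul_le_mul_of_nonneg_left (hpure k).2 (hμ k))
    rw [← Finset.sum_mul, hμ1, one_mul]

end Additivity

end TransposeDepolarizing

open TransposeDepolarizing in
theorem mainTheorem1 :
    (∀ (d : ℕ) (t : ℝ), 2 ≤ d → -(1 / ((d : ℝ) - 1)) ≤ t → t ≤ 1 / ((d : ℝ) + 1) →
      IsLeast (outputEntropies (channel d t)) (minOutputEntropy (channel d t)) ∧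
      IsLeast (outputEntropies (tensor (channel d t) (channel d t)))
        (minOutputEntropy (tensor (channel d t) (channel d t))) ∧
      minOutputEntropy (tensor (channel d t) (channel d t)) =
        2 * minOutputEntropy (channel d t)) ∧
    (∀ (d₁ d₂ : ℕ) (t₁ t₂ : ℝ), 2 ≤ d₁ → 2 ≤ d₂ →
      -(1 / ((d₁ : ℝ) - 1)) ≤ t₁ → t₁ ≤ 0 → -(1 / ((d₂ : ℝ) - 1)) ≤ t₂ → t₂ ≤ 0 →
      IsLeast (outputEntropies (channel d₁ t₁)) (minOutputEntropy (channel d₁ t₁)) ∧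
      IsLeast (outputEntropies (channel d₂ t₂)) (minOutputEntropy (channel d₂ t₂)) ∧
      IsLeast (outputEntropies (tensor (channel d₁ t₁) (channel d₂ t₂)))
        (minOutputEntropy (tensor (channel d₁ t₁) (channel d₂ t₂))) ∧
      minOutputEntropy (tensor (channel d₁ t₁) (channel d₂ t₂)) =
        minOutputEntropy (channel d₁ t₁) + minOutputEntropy (channel d₂ t₂)) := by
  refine ⟨fun d t hd h1 h2 => ?_, fun d₁ d₂ t₁ t₂ hd₁ hd₂ h₁ ht₁ h₂ ht₂ => ?_⟩
  · have ha := isAdmissible hd h1 h2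
    have hc := isLeast_outputEntropies_channel (by omega) ha
    have ht : t ≤ 0 ∧ t ≤ 0 ∨ 0 ≤ t ∧ 0 ≤ t := by
      rcases le_total t 0 with h | h
      · exact Or.inl ⟨h, h⟩
      · exact Or.inr ⟨h, h⟩
    have hT := isLeast_outputEntropies_tensor (by omega) (by omega) ha ha ht
    simp only [minOutputEntropy, hc.csInf_eq, hT.csInf_eq]
    exact ⟨hc, hT, (two_mul _).symm⟩
  · have ha₁ := isAdmissible hd₁ h₁ (ht₁.trans (by positivity))
    have ha₂ := isAdmissible hd₂ h₂ (ht₂.trans (by positivity))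
    have hc₁ := isLeast_outputEntropies_channel (by omega) ha₁
    have hc₂ := isLeast_outputEntropies_channel (by omega) ha₂
    have hT := isLeast_outputEntropies_tensor (by omega) (by omega) ha₁ ha₂ (Or.inl ⟨ht₁, ht₂⟩)
    simp only [minOutputEntropy, hc₁.csInf_eq, hc₂.csInf_eq, hT.csInf_eq]
    exact ⟨hc₁, hc₂, hT, trivial⟩
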